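/- Let $\mathbb{T}=\mathbb{R}/\mathbb{Z}$ with Lebesgue (Haar) probability measure $\mu$, and let $f:\mathbb{T}\to\mathbb{C}$, $f\not\equiv 0$, be complex analytic in a neighborhood of $\mathbb{T}$, i.e. $f$ is the restriction to $\mathbb{R}$ of a $1$-periodic holomorphic function on a strip $\{|\operatorname{Im} z|<\varepsilon\}$, $\varepsilon>0$; zeros of $f$ on $\mathbb{T}$ are allowed. Let $\alpha$ be irrational and let $q_0=1$, $q_1=a_1$, $q_n=a_nq_{n-1}+q_{n-2}$ $(n\ge 2)$ be the denominators of the convergents of the continued fraction $\alpha=[a_0;a_1,a_2,\dots]$. Then $\log|f|$ is integrable over $\mathbb{T}$, and there are a constant $C>0$ and a strictly increasing sequence of indices $(n_l)$ such that, for every $l$ and every $x\in\mathbb{T}$ (with $C$ and $(n_l)$ independent of $x$), $$\frac{1}{q_{n_l}}\sum_{j=0}^{q_{n_l}-1}\log|f(x+j\alpha)|-\int_{\mathbb{T}}\log|f|\,d\mu\;\le\;\frac{C}{q_{n_l}},$$ where $\log 0=-\infty$, so that the left-hand side is $-\infty$ if $f(x+j\alpha)=0$ for some $0\le j<q_{n_l}$.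 -/

import Mathlib

/-- A function on the circle `𝕋 = ℝ/ℤ` that is complex analytic in a neighborhood of `𝕋` in the
cylinder `ℂ/ℤ`: it is the restriction to the real axis of a `1`-periodic holomorphic function on a
strip `|Im z| < ε`. As `𝕋` is compact, every neighborhood of it in `ℂ/ℤ` contains such a strip. -/
def AnalyticNearCircle (f : UnitAddCircle → ℂ) : Prop :=
  ∃ ε : ℝ, 0 < ε ∧ ∃ F : ℂ → ℂ,
    DifferentiableOn ℂ F {z : ℂ | |z.im| < ε} ∧
    (∀ z : ℂ, |z.im| < ε → F (z + 1) = F z) ∧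
    ∀ t : ℝ, f (t : UnitAddCircle) = F (t : ℂ)

/-- The denominator `q_n` of the `n`-th convergent of the continued fraction of `α`, as a natural
number (`q_0 = 1`, `q_1 = a_1`, `q_n = a_n q_{n-1} + q_{n-2}`). -/
noncomputable def cfDen (α : ℝ) (n : ℕ) : ℕ :=
  ⌊(GenContFract.of α).dens n⌋₊

/-- Mathlib's real-valued convergent denominators are natural numbers, so no information is lost
in `cfDen`. -/
theorem cfDen_cast (α : ℝ) (n : ℕ) : (cfDen α n : ℝ) = (GenContFract.of α).dens n := by
  have key : ∀ m : ℕ, (∃ z : ℤ, ((GenContFract.of α).contsAux m).b = (z : ℝ)) ∧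
      ∃ z : ℤ, ((GenContFract.of α).contsAux (m + 1)).b = (z : ℝ) := by
    intro m
    induction m with
    | zero => exact ⟨⟨0, by simp⟩, ⟨1, by simp⟩⟩
    | succ m ih =>
      refine ⟨ih.2, ?_⟩
      obtain ⟨⟨u, hu⟩, ⟨v, hv⟩⟩ := ih
      rcases hs : (GenContFract.of α).s.get? m with _ | gp
      · refine ⟨v, ?_⟩
        rw [← hv, GenContFract.contsAux_stable_step_of_terminated hs]
      · obtain ⟨ha, z, hz⟩ :=
          GenContFract.of_partNum_eq_one_and_exists_int_partDen_eq hs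
        refine ⟨z * v + u, ?_⟩
        rw [GenContFract.contsAux_recurrence hs rfl rfl]
        simp [ha, hz, hu, hv]
  obtain ⟨z, hz⟩ := (key n).2
  have hd : (GenContFract.of α).dens n = (z : ℝ) := hz
  have h0 : (0 : ℝ) ≤ (GenContFract.of α).dens n := GenContFract.zero_le_of_den
  have hz0 : 0 ≤ z := by
    rw [hd] at h0
    exact_mod_cast h0
  lift z to ℕ using hz0
  unfold cfDen
  rw [hd]
  simp

/-- The logarithm `log |w|` of the modulus of a complex number, with values in `[-∞, ∞)`:
it is `-∞` exactly at `w = 0`. -/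
noncomputable def logAbs (w : ℂ) : EReal :=
  ENNReal.log ‖w‖ₑ

theorem logAbs_zero : logAbs 0 = ⊥ := by
  simp [logAbs]

theorem logAbs_of_ne_zero {w : ℂ} (hw : w ≠ 0) : logAbs w = ((Real.log ‖w‖ : ℝ) : EReal) := by
  rw [logAbs, ← ofReal_norm, ENNReal.log_ofReal_of_pos (norm_pos_iff.mpr hw)]

/-! Write `f(t) = φ(e^{2πit})` and split off the zeros: on the unit circle `φ` is a product of
factors `z - u`, `|u| = 1`, and a zero-free analytic `g`. Since `log |g|` is Lipschitz,
Denjoy–Koksma (`sum_lipschitz_le_mul_integral_add`) handles it at every `q_n`. Each `log |z - u|`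
has mean zero, so its Birkhoff sums must be bounded above by a constant.

Replace `1 - e^{2πix}` by `1 - r e^{2πix}` with `r = 1 - 1/(2 q_n)`; for an upper bound this costs
O(1). For the rotation by `p_n / q_n` the product of the factors is `1 - z^{q_n}`, of modulus at
most 2. Moving the angle from `p_n / q_n` to `α` costs at most `1/(q_n q_{n+1})` times a bound on `∑
j * conjPoisson r (x + j β)`, uniform in intermediate `β`.

This kernel is odd, hence a superposition of odd step functions, whose orbit sums have no main term.
Choosing a suitable earlier denominator at each scale bounds the weighted sum by `O((R + 7) q_n²)`,
where `R` bounds `q_{l+1}/q_l` for `l < n` (`ConvergentData.abs_sum_conjPoisson_le`). The cost `O((R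
+ 7) q_n / q_{n+1})` stays bounded at those `n` whose ratio `q_{n+1}/q_n` dominates all earlier ones
up to a constant; there are infinitely many (`exists_strictMono_forall_lt_le_mul`). -/

/-! ### Discrepancy of rotation orbits -/

/-- A finite set of integers in a real interval of length `b - a` has at most `b - a + 1`
elements. -/
lemma Finset.card_le_of_forall_mem_Icc_real {S : Finset ℤ} {a b : ℝ} (hab : a ≤ b)
    (hS : ∀ k ∈ S, (k : ℝ) ∈ Set.Icc a b) : (S.card : ℝ) ≤ b - a + 1 := by
  have hsub : S ⊆ Finset.Icc ⌈a⌉ ⌊b⌋ := fun k hk => by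
    rw [Finset.mem_Icc]
    exact ⟨Int.ceil_le.mpr (hS k hk).1, Int.le_floor.mpr (hS k hk).2⟩
  have hcard := Finset.card_le_card hsub
  rw [Int.card_Icc] at hcard
  have h1 : (S.card : ℝ) ≤ ((⌊b⌋ + 1 - ⌈a⌉).toNat : ℝ) := by exact_mod_cast hcard
  refine h1.trans ?_
  rcases le_total 0 (⌊b⌋ + 1 - ⌈a⌉) with h | h
  · have : (((⌊b⌋ + 1 - ⌈a⌉).toNat : ℤ) : ℝ) = ((⌊b⌋ + 1 - ⌈a⌉ : ℤ) : ℝ) := by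
      rw [Int.toNat_of_nonneg h]
    have h2 : ((⌊b⌋ + 1 - ⌈a⌉).toNat : ℝ) = (⌊b⌋ : ℝ) + 1 - ⌈a⌉ := by
      rw [← Int.cast_natCast (R := ℝ), this]; push_cast; ring
    rw [h2]
    linarith [Int.floor_le b, Int.le_ceil a]
  · rw [Int.toNat_of_nonpos h]
    push_cast
    linarith

/-- Among `Q` consecutive points of an orbit of the rotation by `β`, where `P / Q` is a good
approximation of `β`, at most `Q * t + 5` lie in a given arc of length `t`. -/
lemma card_orbit_filter_fract_lt_le {β : ℝ} {P : ℤ} {Q : ℕ} (hQ : 0 < Q) (hPQ : IsCoprime P Q)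
    (hβ : |β - P / Q| ≤ 2 / (Q : ℝ) ^ 2) (x a : ℝ) {t : ℝ} (ht : 0 ≤ t) :
    (((Finset.range Q).filter (fun j : ℕ => Int.fract (x + j * β - a) < t)).card : ℝ)
      ≤ Q * t + 5 := by
  set S := (Finset.range Q).filter (fun j : ℕ => Int.fract (x + j * β - a) < t) with hS
  have hQ' : (0 : ℝ) < Q := by exact_mod_cast hQ
  -- Up to a fixed shift and an error of at most 2, `k j` is `Q` times the fractional part, so it
  -- lies in an interval of length `Q * t + 4`. It is injective because `P` is invertible modulo
  -- `Q`.
  let k : ℕ → ℤ := fun j => j * P - Q * ⌊x + j * β - a⌋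
  have hinj : Set.InjOn k S := by
    intro i hi j hj hij
    simp only [hS, Finset.coe_filter, Finset.mem_range, Set.mem_ofPred_eq] at hi hj
    have h1 : (Q : ℤ) ∣ ((i : ℤ) - j) * P := by
      refine ⟨⌊x + i * β - a⌋ - ⌊x + j * β - a⌋, ?_⟩
      simp only [k] at hij
      linarith
    have h2 : (Q : ℤ) ∣ (i : ℤ) - j := hPQ.symm.dvd_of_dvd_mul_right h1
    have h3 : (i : ℤ) ≡ j [ZMOD Q] := (Int.modEq_iff_dvd.mpr h2).symm
    have h4 : i ≡ j [MOD Q] := (Int.natCast_modEq_iff).mp h3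
    exact Nat.ModEq.eq_of_lt_of_lt h4 hi.1 hj.1
  rw [← Finset.card_image_of_injOn hinj]
  have key := Finset.card_le_of_forall_mem_Icc_real (S := S.image k)
    (a := -(Q * (x - a)) - 2) (b := Q * t - Q * (x - a) + 2)
    (by nlinarith [mul_nonneg hQ'.le ht]) ?_
  · linarith
  · intro m hm
    obtain ⟨j, hj, rfl⟩ := Finset.mem_image.mp hm
    simp only [hS, Finset.mem_filter, Finset.mem_range] at hj
    have hfr := Int.floor_add_fract (x + j * β - a)
    have hf0 := Int.fract_nonneg (x + j * β - a)
    set φ := Int.fract (x + j * β - a)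
    have hk : ((k j : ℤ) : ℝ) = Q * φ - Q * (x - a) - j * (Q * (β - P / Q)) := by
      have : (⌊x + j * β - a⌋ : ℝ) = x + j * β - a - φ := by linarith
      simp only [k]
      push_cast
      rw [this]
      field_simp
      ring
    have hjQ : (j : ℝ) ≤ Q := by exact_mod_cast hj.1.le
    have herr : |(j : ℝ) * (Q * (β - P / Q))| ≤ 2 := by
      rw [abs_mul, abs_mul, Nat.abs_cast, Nat.abs_cast]
      calc (j : ℝ) * (Q * |β - P / Q|) ≤ Q * (Q * (2 / (Q : ℝ) ^ 2)) := by gcongr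
        _ = 2 := by field_simp
    have := abs_le.mp herr
    rw [hk]
    have h1 : 0 ≤ Q * φ := by positivity
    have h2 : Q * φ ≤ Q * t := mul_le_mul_of_nonneg_left hj.2.le hQ'.le
    constructor <;> linarith

/-- The odd step function `1_{[0, t)} - 1_{[1 - t, 1)}`, periodically extended. -/
noncomputable def arcSign (t y : ℝ) : ℝ :=
  (if Int.fract y < t then 1 else 0) - (if 1 - t ≤ Int.fract y then 1 else 0)

lemma fract_add_lt_of_one_sub_le_fract {t y : ℝ} (ht1 : t ≤ 1)
    (h : 1 - t ≤ Int.fract y) : Int.fract (y + t) < t := by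
  have h1 := Int.fract_lt_one y
  have h2 : Int.fract (y + t) = Int.fract y + t - 1 := by
    rw [Int.fract_eq_iff]
    refine ⟨by linarith, by linarith, ⌊y⌋ + 1, ?_⟩
    have := Int.floor_add_fract y
    push_cast
    linarith
  linarith

section Block

variable {β : ℝ} {P : ℤ} {Q : ℕ}

lemma sum_ite_fract_lt_le (hQ : 0 < Q) (hPQ : IsCoprime P Q)
    (hβ : |β - P / Q| ≤ 2 / (Q : ℝ) ^ 2) (x : ℝ) {t : ℝ} (ht : 0 ≤ t) :
    ∑ j ∈ Finset.range Q, (if Int.fract (x + j * β) < t then (1 : ℝ) else 0) ≤ Q * t + 5 := by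
  rw [Finset.sum_boole]
  simpa using card_orbit_filter_fract_lt_le hQ hPQ hβ x 0 ht

lemma sum_ite_le_fract_le (hQ : 0 < Q) (hPQ : IsCoprime P Q)
    (hβ : |β - P / Q| ≤ 2 / (Q : ℝ) ^ 2) (x : ℝ) {t : ℝ} (ht : 0 ≤ t) (ht1 : t ≤ 1) :
    ∑ j ∈ Finset.range Q, (if 1 - t ≤ Int.fract (x + j * β) then (1 : ℝ) else 0)
      ≤ Q * t + 5 := by
  rw [Finset.sum_boole]
  refine le_trans ?_ (card_orbit_filter_fract_lt_le hQ hPQ hβ x (-t) ht)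
  refine Nat.cast_le.mpr (Finset.card_le_card ?_)
  refine Finset.monotone_filter_right _ fun j hj => ?_
  rw [sub_neg_eq_add]
  exact fract_add_lt_of_one_sub_le_fract ht1

/-- The upper count for the complementary arc, subtracted from the `Q` points in all. -/
lemma le_sum_ite_fract_lt (hQ : 0 < Q) (hPQ : IsCoprime P Q)
    (hβ : |β - P / Q| ≤ 2 / (Q : ℝ) ^ 2) (x : ℝ) {t : ℝ} (ht : 0 ≤ t) (ht1 : t ≤ 1) :
    Q * t - 5 ≤ ∑ j ∈ Finset.range Q, (if Int.fract (x + j * β) < t then (1 : ℝ) else 0) := by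
  have h := sum_ite_le_fract_le hQ hPQ hβ x (t := 1 - t) (by linarith) (by linarith)
  have h2 : ∑ j ∈ Finset.range Q, ((if Int.fract (x + j * β) < t then (1 : ℝ) else 0) +
      (if 1 - (1 - t) ≤ Int.fract (x + j * β) then (1 : ℝ) else 0)) = Q := by
    rw [Finset.sum_congr rfl (g := fun _ => (1 : ℝ))]
    · simp
    · intro j _
      rw [sub_sub_cancel]
      split_ifs <;> linarith
  rw [Finset.sum_add_distrib] at h2
  linarith

lemma le_sum_ite_le_fract (hQ : 0 < Q) (hPQ : IsCoprime P Q)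
    (hβ : |β - P / Q| ≤ 2 / (Q : ℝ) ^ 2) (x : ℝ) {t : ℝ} (ht1 : t ≤ 1) :
    Q * t - 5 ≤
      ∑ j ∈ Finset.range Q, (if 1 - t ≤ Int.fract (x + j * β) then (1 : ℝ) else 0) := by
  have h := sum_ite_fract_lt_le hQ hPQ hβ x (t := 1 - t) (by linarith)
  have h2 : ∑ j ∈ Finset.range Q, ((if Int.fract (x + j * β) < 1 - t then (1 : ℝ) else 0) +
      (if 1 - t ≤ Int.fract (x + j * β) then (1 : ℝ) else 0)) = Q := by
    rw [Finset.sum_congr rfl (g := fun _ => (1 : ℝ))]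
    · simp
    · intro j _
      split_ifs <;> linarith
  rw [Finset.sum_add_distrib] at h2
  linarith

/-- The two arcs have equal length, so the main terms `Q * t` cancel and the bound does not depend
on `t`. -/
lemma abs_sum_arcSign_block_le (hQ : 0 < Q) (hPQ : IsCoprime P Q)
    (hβ : |β - P / Q| ≤ 2 / (Q : ℝ) ^ 2) (x : ℝ) {t : ℝ} (ht : 0 ≤ t) (ht1 : t ≤ 1) :
    |∑ j ∈ Finset.range Q, arcSign t (x + j * β)| ≤ 10 := by
  simp only [arcSign, Finset.sum_sub_distrib]
  have h1 := sum_ite_fract_lt_le hQ hPQ hβ x ht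
  have h2 := sum_ite_le_fract_le hQ hPQ hβ x ht ht1
  have h3 := le_sum_ite_fract_lt hQ hPQ hβ x ht ht1
  have h4 := le_sum_ite_le_fract hQ hPQ hβ x ht1
  rw [abs_le]
  constructor <;> linarith

/-- An incomplete block offers no cancellation; it is bounded by the number of points of a full
block in the two arcs. -/
lemma abs_sum_arcSign_le_of_le (hQ : 0 < Q) (hPQ : IsCoprime P Q)
    (hβ : |β - P / Q| ≤ 2 / (Q : ℝ) ^ 2) (x : ℝ) {t : ℝ} (ht : 0 ≤ t) (ht1 : t ≤ 1)
    {N : ℕ} (hN : N ≤ Q) :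
    |∑ j ∈ Finset.range N, arcSign t (x + j * β)| ≤ 2 * Q * t + 10 := by
  have h1 := sum_ite_fract_lt_le hQ hPQ hβ x ht
  have h2 := sum_ite_le_fract_le hQ hPQ hβ x ht ht1
  calc |∑ j ∈ Finset.range N, arcSign t (x + j * β)|
      ≤ ∑ j ∈ Finset.range N, |arcSign t (x + j * β)| := Finset.abs_sum_le_sum_abs _ _
    _ ≤ ∑ j ∈ Finset.range N, ((if Int.fract (x + j * β) < t then (1 : ℝ) else 0) +
          (if 1 - t ≤ Int.fract (x + j * β) then (1 : ℝ) else 0)) := by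
        refine Finset.sum_le_sum fun j _ => ?_
        unfold arcSign
        split_ifs <;> norm_num
    _ ≤ ∑ j ∈ Finset.range Q, ((if Int.fract (x + j * β) < t then (1 : ℝ) else 0) +
          (if 1 - t ≤ Int.fract (x + j * β) then (1 : ℝ) else 0)) := by
        refine Finset.sum_le_sum_of_subset_of_nonneg (Finset.range_mono hN) fun j _ _ => ?_
        split_ifs <;> norm_num
    _ ≤ 2 * Q * t + 10 := by
        rw [Finset.sum_add_distrib]
        linarith

/-- Cut the orbit into blocks of length `Q`: each full block costs 10, and one incomplete block
remains. -/
lemma abs_sum_arcSign_le (hQ : 0 < Q) (hPQ : IsCoprime P Q)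
    (hβ : |β - P / Q| ≤ 2 / (Q : ℝ) ^ 2) {t : ℝ} (ht : 0 ≤ t) (ht1 : t ≤ 1) (N : ℕ) (x : ℝ) :
    |∑ j ∈ Finset.range N, arcSign t (x + j * β)| ≤ 10 * N / Q + (2 * Q * t + 10) := by
  have hQ' : (0 : ℝ) < Q := by exact_mod_cast hQ
  induction N using Nat.strong_induction_on generalizing x with
  | _ N ih =>
    rcases le_total N Q with hN | hN
    · refine (abs_sum_arcSign_le_of_le hQ hPQ hβ x ht ht1 hN).trans ?_
      have : (0 : ℝ) ≤ 10 * N / Q := by positivity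
      linarith
    · obtain ⟨M, rfl⟩ := Nat.exists_eq_add_of_le hN
      have h1 := ih M (by omega) (x + Q * β)
      have h2 := abs_sum_arcSign_block_le hQ hPQ hβ x ht ht1
      rw [Finset.sum_range_add]
      have h3 : ∑ j ∈ Finset.range M, arcSign t (x + ((Q + j : ℕ) : ℝ) * β) =
          ∑ j ∈ Finset.range M, arcSign t (x + Q * β + j * β) := by
        refine Finset.sum_congr rfl fun j _ => ?_
        congr 1
        push_cast
        ring
      rw [h3]
      refine (abs_add_le _ _).trans ?_
      have h4 : (10 : ℝ) * ((Q + M : ℕ) : ℝ) / Q = 10 + 10 * M / Q := by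
        push_cast
        field_simp
      rw [h4]
      linarith

end Block

/-- Summation by parts against the weight `j`. -/
lemma abs_sum_range_natCast_mul_le {c : ℕ → ℝ} {M : ℝ} {q : ℕ}
    (h : ∀ N ≤ q, |∑ j ∈ Finset.range N, c j| ≤ M) :
    |∑ j ∈ Finset.range q, (j : ℝ) * c j| ≤ 2 * q * M := by
  have hid : ∀ n : ℕ, ∑ j ∈ Finset.range n, (j : ℝ) * c j =
      n * ∑ j ∈ Finset.range n, c j -
        ∑ m ∈ Finset.range n, ∑ j ∈ Finset.range (m + 1), c j := by
    intro n
    induction n with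
    | zero => simp
    | succ n ih =>
      rw [Finset.sum_range_succ, ih, Finset.sum_range_succ _ n,
        Finset.sum_range_succ (fun m => ∑ j ∈ Finset.range (m + 1), c j) n,
        Finset.sum_range_succ _ n]
      push_cast
      ring
  rw [hid q]
  refine (abs_sub _ _).trans ?_
  have h1 : |(q : ℝ) * ∑ j ∈ Finset.range q, c j| ≤ q * M := by
    rw [abs_mul, Nat.abs_cast]
    exact mul_le_mul_of_nonneg_left (h q le_rfl) (Nat.cast_nonneg q)
  have h2 : |∑ m ∈ Finset.range q, ∑ j ∈ Finset.range (m + 1), c j| ≤ q * M := by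
    refine (Finset.abs_sum_le_sum_abs _ _).trans ?_
    refine (Finset.sum_le_card_nsmul _ _ M fun m hm => h _ ?_).trans ?_
    · exact Finset.mem_range.mp hm
    · simp
  linarith

/-- The scale `Q` is free: `q / Q` counts full blocks, `Q * t` is the uncancelled remainder, and the
two balance at `Q ≈ √(q / t)`. -/
lemma abs_sum_natCast_mul_arcSign_le {β : ℝ} {P : ℤ} {Q q : ℕ} (hQ : 0 < Q)
    (hPQ : IsCoprime P Q) (hβ : |β - P / Q| ≤ 2 / (Q : ℝ) ^ 2) {t : ℝ} (ht : 0 ≤ t)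
    (ht1 : t ≤ 1) (x : ℝ) :
    |∑ j ∈ Finset.range q, (j : ℝ) * arcSign t (x + j * β)|
      ≤ 20 * q * (q / Q + Q * t + 1) := by
  refine (abs_sum_range_natCast_mul_le (M := 10 * (q / Q + Q * t + 1)) fun N hN => ?_).trans ?_
  · refine (abs_sum_arcSign_le hQ hPQ hβ ht ht1 N x).trans ?_
    have h1 : (10 : ℝ) * N / Q ≤ 10 * q / Q := by gcongr
    have h2 : (0 : ℝ) ≤ Q * t := by positivity
    have h3 : (10 : ℝ) * q / Q = 10 * (q / Q) := by ring
    linarith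
  · exact le_of_eq (by ring)

/-! ### The regularized logarithm and its conjugate Poisson kernel -/

/-- The squared modulus `|1 - r e^{2πix}|²`. -/
noncomputable def normSqOneSub (r x : ℝ) : ℝ := 1 + r ^ 2 - 2 * r * Real.cos (2 * Real.pi * x)

/-- The derivative of `x ↦ log |1 - r e^{2πix}|`. -/
noncomputable def conjPoisson (r x : ℝ) : ℝ :=
  2 * Real.pi * r * Real.sin (2 * Real.pi * x) / normSqOneSub r x

/-- The derivative of `conjPoisson r`. -/
noncomputable def conjPoissonDeriv (r x : ℝ) : ℝ :=
  (4 * Real.pi ^ 2 * r * Real.cos (2 * Real.pi * x) * normSqOneSub r x -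
    8 * Real.pi ^ 2 * r ^ 2 * Real.sin (2 * Real.pi * x) ^ 2) / normSqOneSub r x ^ 2

section Kernel

variable {r : ℝ}

lemma normSqOneSub_pos (h0 : 0 ≤ r) (h1 : r < 1) (x : ℝ) : 0 < normSqOneSub r x := by
  unfold normSqOneSub
  nlinarith [Real.cos_le_one (2 * Real.pi * x), mul_le_mul_of_nonneg_left
    (Real.cos_le_one (2 * Real.pi * x)) h0, sq_pos_of_pos (sub_pos.mpr h1)]

lemma hasDerivAt_normSqOneSub (r x : ℝ) :
    HasDerivAt (normSqOneSub r) (4 * Real.pi * r * Real.sin (2 * Real.pi * x)) x := by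
  unfold normSqOneSub
  have h := (((hasDerivAt_id x).const_mul (2 * Real.pi)).cos.const_mul (2 * r)).const_sub
    (1 + r ^ 2)
  refine h.congr_deriv ?_
  simp only [id]
  ring

lemma hasDerivAt_log_normSqOneSub (h0 : 0 ≤ r) (h1 : r < 1) (x : ℝ) :
    HasDerivAt (fun y => Real.log (normSqOneSub r y) / 2) (conjPoisson r x) x := by
  refine (((hasDerivAt_normSqOneSub r x).log (normSqOneSub_pos h0 h1 x).ne').div_const
    2).congr_deriv ?_
  unfold conjPoisson
  ring

lemma hasDerivAt_conjPoisson (h0 : 0 ≤ r) (h1 : r < 1) (x : ℝ) :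
    HasDerivAt (conjPoisson r) (conjPoissonDeriv r x) x := by
  unfold conjPoisson
  have hs := ((hasDerivAt_id x).const_mul (2 * Real.pi)).sin.const_mul (2 * Real.pi * r)
  refine (hs.div (hasDerivAt_normSqOneSub r x) (normSqOneSub_pos h0 h1 x).ne').congr_deriv ?_
  unfold conjPoissonDeriv
  simp only [id]
  ring

lemma continuous_normSqOneSub (r : ℝ) : Continuous (normSqOneSub r) := by
  unfold normSqOneSub
  fun_prop

lemma continuous_conjPoissonDeriv (h0 : 0 ≤ r) (h1 : r < 1) :
    Continuous (conjPoissonDeriv r) := by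
  unfold conjPoissonDeriv
  have := continuous_normSqOneSub r
  exact Continuous.div (by fun_prop) (by fun_prop)
    fun x => pow_ne_zero 2 (normSqOneSub_pos h0 h1 x).ne'

lemma normSqOneSub_add_intCast (r x : ℝ) (m : ℤ) :
    normSqOneSub r (x + m) = normSqOneSub r x := by
  unfold normSqOneSub
  rw [show 2 * Real.pi * (x + m) = 2 * Real.pi * x + m * (2 * Real.pi) by ring,
    Real.cos_add_int_mul_two_pi]

lemma conjPoisson_fract (r x : ℝ) : conjPoisson r (Int.fract x) = conjPoisson r x := by
  conv_rhs => rw [← Int.fract_add_floor x]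
  unfold conjPoisson
  rw [normSqOneSub_add_intCast, show 2 * Real.pi * (Int.fract x + ⌊x⌋) =
    2 * Real.pi * Int.fract x + ⌊x⌋ * (2 * Real.pi) by ring, Real.sin_add_int_mul_two_pi]

lemma conjPoisson_one_sub (r x : ℝ) : conjPoisson r (1 - x) = -conjPoisson r x := by
  unfold conjPoisson normSqOneSub
  rw [show 2 * Real.pi * (1 - x) = 2 * Real.pi - 2 * Real.pi * x by ring,
    Real.sin_two_pi_sub, Real.cos_two_pi_sub]
  ring

lemma conjPoisson_half (r : ℝ) : conjPoisson r (1 / 2) = 0 := by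
  unfold conjPoisson
  rw [show 2 * Real.pi * (1 / 2) = Real.pi by ring]
  simp

lemma integral_conjPoissonDeriv (h0 : 0 ≤ r) (h1 : r < 1) (a b : ℝ) :
    ∫ t in a..b, conjPoissonDeriv r t = conjPoisson r b - conjPoisson r a :=
  intervalIntegral.integral_eq_sub_of_hasDerivAt
    (fun x _ => hasDerivAt_conjPoisson h0 h1 x)
    ((continuous_conjPoissonDeriv h0 h1).intervalIntegrable _ _)

lemma measurable_arcSign (y : ℝ) : Measurable (fun t => arcSign t y) := by
  unfold arcSign
  refine Measurable.sub ?_ ?_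
  · exact Measurable.ite measurableSet_Ioi measurable_const measurable_const
  · refine Measurable.ite ?_ measurable_const measurable_const
    exact measurableSet_le (measurable_const.sub measurable_id) measurable_const

lemma abs_arcSign_le (t y : ℝ) : |arcSign t y| ≤ 1 := by
  unfold arcSign
  split_ifs <;> norm_num

lemma intervalIntegrable_arcSign_mul (h0 : 0 ≤ r) (h1 : r < 1) (y a b : ℝ) :
    IntervalIntegrable (fun t => arcSign t y * conjPoissonDeriv r t) MeasureTheory.volume a b := by
  have h := (continuous_conjPoissonDeriv h0 h1).intervalIntegrable (μ := MeasureTheory.volume) a b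
  have hb : ∀ μ : MeasureTheory.Measure ℝ, ∀ᵐ t ∂μ, ‖arcSign t y‖ ≤ 1 := fun μ =>
    Filter.Eventually.of_forall fun t => abs_arcSign_le t y
  exact ⟨h.1.bdd_mul (measurable_arcSign y).aestronglyMeasurable (hb _),
    h.2.bdd_mul (measurable_arcSign y).aestronglyMeasurable (hb _)⟩

/-- The conjugate Poisson kernel as a superposition of odd step functions. -/
lemma conjPoisson_eq_neg_integral (h0 : 0 ≤ r) (h1 : r < 1) (y : ℝ) :
    conjPoisson r y = -∫ t in (0 : ℝ)..(1 / 2), arcSign t y * conjPoissonDeriv r t := by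
  rw [← conjPoisson_fract r y]
  have hy0 := Int.fract_nonneg y
  have hy1 := Int.fract_lt_one y
  unfold arcSign
  have hint := intervalIntegrable_arcSign_mul h0 h1 y
  unfold arcSign at hint
  set z := Int.fract y with hz
  -- The step function vanishes until `t` passes the distance from `z` to the nearest integer.
  -- Beyond it the integral is explicit, as the kernel vanishes at `1 / 2`; the second case uses
  -- oddness.
  rcases lt_or_ge z (1 / 2) with h | h
  · rw [← intervalIntegral.integral_add_adjacent_intervals (hint 0 z) (hint z (1 / 2)),
      intervalIntegral.integral_congr_Ioo_of_le (g := fun _ => (0 : ℝ)) hy0,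
      intervalIntegral.integral_congr_Ioo_of_le (g := conjPoissonDeriv r) h.le,
      integral_conjPoissonDeriv h0 h1, conjPoisson_half]
    · simp
    · intro t ht
      have h2 : ¬ (1 - t ≤ z) := by linarith [ht.2]
      simp [ht.1, h2]
    · intro t ht
      have h2 : ¬ (1 - t ≤ z) := by linarith [ht.2]
      have h3 : ¬ (z < t) := not_lt.mpr ht.2.le
      simp [h2, h3]
  · have h' : 0 ≤ 1 - z := by linarith
    have h'' : 1 - z ≤ 1 / 2 := by linarith
    rw [← intervalIntegral.integral_add_adjacent_intervals (hint 0 (1 - z))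
        (hint (1 - z) (1 / 2)),
      intervalIntegral.integral_congr_Ioo_of_le (g := fun _ => (0 : ℝ)) h',
      intervalIntegral.integral_congr_Ioo_of_le (g := fun t => -conjPoissonDeriv r t) h'',
      intervalIntegral.integral_neg, integral_conjPoissonDeriv h0 h1, conjPoisson_half,
      conjPoisson_one_sub]
    · simp
    · intro t ht
      have h2 : 1 - t ≤ z := by linarith [ht.1]
      have h3 : ¬ (z < t) := by linarith [ht.2]
      simp [h2, h3]
    · intro t ht
      have h2 : ¬ (1 - t ≤ z) := by linarith [ht.2]
      have h3 : ¬ (z < t) := by linarith [ht.2]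
      simp [h2, h3]

/-- The squared modulus is `(1 - r)² + 4 r sin²(πt)`, and `sin (πt) ≥ 2t` on `[0, 1/2]`. -/
lemma four_mul_sq_le_normSqOneSub {δ t : ℝ} (hδ' : δ ≤ 1 / 8)
    (ht0 : 0 ≤ t) (ht : t ≤ 1 / 2) : 4 * (t + δ) ^ 2 ≤ normSqOneSub (1 - 4 * δ) t := by
  have hsin : 2 * t ≤ Real.sin (Real.pi * t) := by
    have := Real.mul_le_sin (x := Real.pi * t) (by positivity)
      (by nlinarith [Real.pi_pos])
    convert this using 1
    field_simp
  have hcos : Real.cos (2 * Real.pi * t) = 1 - 2 * Real.sin (Real.pi * t) ^ 2 := by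
    rw [show 2 * Real.pi * t = 2 * (Real.pi * t) by ring, Real.cos_two_mul, Real.cos_sq']
    ring
  have hsq : (2 * t) ^ 2 ≤ Real.sin (Real.pi * t) ^ 2 :=
    pow_le_pow_left₀ (by positivity) hsin 2
  unfold normSqOneSub
  rw [hcos]
  nlinarith [sq_nonneg (t - δ), sq_nonneg δ,
    mul_le_mul_of_nonneg_left hsq (show (0 : ℝ) ≤ 1 - 4 * δ by linarith),
    mul_nonneg (sq_nonneg t) (show (0 : ℝ) ≤ 1 / 2 - 4 * δ by linarith)]

lemma abs_conjPoissonDeriv_le_div (h0 : 0 ≤ r) (h1 : r < 1) (t : ℝ) :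
    |conjPoissonDeriv r t| ≤ 12 * Real.pi ^ 2 / normSqOneSub r t := by
  have hA := normSqOneSub_pos h0 h1 t
  -- The difference of the two sides is `(1 - r)² + r (1 - cos)²`.
  have hsA : r * Real.sin (2 * Real.pi * t) ^ 2 ≤ normSqOneSub r t := by
    rw [Real.sin_sq]
    unfold normSqOneSub
    nlinarith [mul_nonneg h0 (sq_nonneg (1 - Real.cos (2 * Real.pi * t))), sq_nonneg (1 - r)]
  unfold conjPoissonDeriv
  rw [abs_div, abs_of_pos (pow_pos hA 2), div_le_div_iff₀ (pow_pos hA 2) hA]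
  have hc := Real.abs_cos_le_one (2 * Real.pi * t)
  set A := normSqOneSub r t
  set c := Real.cos (2 * Real.pi * t)
  set s := Real.sin (2 * Real.pi * t)
  have h3 : |4 * Real.pi ^ 2 * r * c * A| ≤ 4 * Real.pi ^ 2 * A := by
    rw [abs_mul, abs_mul, abs_of_pos hA, abs_of_nonneg (by positivity : 0 ≤ 4 * Real.pi ^ 2 * r)]
    have : r * |c| ≤ 1 * 1 := mul_le_mul h1.le hc (abs_nonneg _) zero_le_one
    have h4 : 0 ≤ 4 * Real.pi ^ 2 * A := by positivity
    nlinarith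
  have h5 : |8 * Real.pi ^ 2 * r ^ 2 * s ^ 2| ≤ 8 * Real.pi ^ 2 * A := by
    rw [abs_of_nonneg (by positivity)]
    have : r * (r * s ^ 2) ≤ 1 * A := mul_le_mul h1.le hsA (by positivity) zero_le_one
    have h4 : 0 ≤ 8 * Real.pi ^ 2 := by positivity
    nlinarith
  have h6 := (abs_sub (4 * Real.pi ^ 2 * r * c * A) (8 * Real.pi ^ 2 * r ^ 2 * s ^ 2)).trans
    (add_le_add h3 h5)
  calc _ ≤ (4 * Real.pi ^ 2 * A + 8 * Real.pi ^ 2 * A) * A :=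
        mul_le_mul_of_nonneg_right h6 hA.le
    _ = _ := by ring

lemma abs_conjPoissonDeriv_le {δ t : ℝ} (hδ : 0 < δ) (hδ' : δ ≤ 1 / 8)
    (ht0 : 0 ≤ t) (ht : t ≤ 1 / 2) : |conjPoissonDeriv (1 - 4 * δ) t| ≤ 30 / (t + δ) ^ 2 := by
  refine (abs_conjPoissonDeriv_le_div (by linarith) (by linarith) t).trans ?_
  have hpi : Real.pi ^ 2 ≤ 10 := by nlinarith [Real.pi_lt_d2, Real.pi_pos]
  calc 12 * Real.pi ^ 2 / normSqOneSub (1 - 4 * δ) t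
      ≤ 12 * 10 / (4 * (t + δ) ^ 2) := by
        gcongr
        exact four_mul_sq_le_normSqOneSub hδ' ht0 ht
    _ = 30 / (t + δ) ^ 2 := by
        have : t + δ ≠ 0 := by positivity
        field_simp
        norm_num

/-- The kernel derivative `(t + δ)⁻²` meets a discrepancy `√(t + δ)`; the product has antiderivative
`-2 / √(t + δ)`. -/
lemma integral_inv_mul_sqrt_le {δ : ℝ} (hδ : 0 < δ) :
    IntervalIntegrable (fun t => ((t + δ) * √(t + δ))⁻¹) MeasureTheory.volume 0 (1 / 2) ∧
    ∫ t in (0 : ℝ)..(1 / 2), ((t + δ) * √(t + δ))⁻¹ ≤ 2 / √δ := by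
  have hI : IntervalIntegrable (fun t => ((t + δ) * √(t + δ))⁻¹) MeasureTheory.volume 0 (1 / 2) := by
    refine ContinuousOn.intervalIntegrable (ContinuousOn.inv₀ (by fun_prop) fun t ht => ?_)
    rw [Set.uIcc_of_le (by norm_num)] at ht
    have : 0 < t + δ := by linarith [ht.1]
    positivity
  refine ⟨hI, ?_⟩
  rw [intervalIntegral.integral_eq_sub_of_hasDerivAt (f := fun t => -2 / √(t + δ)) _ hI]
  · have : 0 ≤ 2 / √(1 / 2 + δ) := by positivity
    simp only [zero_add, neg_div]
    linarith
  · intro t ht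
    rw [Set.uIcc_of_le (by norm_num)] at ht
    have hp : 0 < t + δ := by linarith [ht.1]
    have h := (hasDerivAt_const t (-2 : ℝ)).div (((hasDerivAt_id t).add_const δ).sqrt hp.ne')
      (Real.sqrt_pos.mpr hp).ne'
    refine h.congr_deriv ?_
    have hs := Real.sqrt_pos.mpr hp
    have hsq := Real.sq_sqrt hp.le
    simp only [id]
    rw [hsq]
    field_simp
    ring

/-- If the weighted odd discrepancy sums of a finite family of points are at most `B √(t + δ)`,
then the weighted sum of the conjugate Poisson kernel is `O(B / √δ)`. -/
lemma abs_sum_mul_conjPoisson_le {δ B : ℝ} (hδ : 0 < δ) (hδ' : δ ≤ 1 / 8) {q : ℕ}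
    {c y : ℕ → ℝ} (h : ∀ t, 0 ≤ t → t ≤ 1 / 2 →
      |∑ j ∈ Finset.range q, c j * arcSign t (y j)| ≤ B * √(t + δ)) :
    |∑ j ∈ Finset.range q, c j * conjPoisson (1 - 4 * δ) (y j)| ≤ 60 * B / √δ := by
  have h0 : (0 : ℝ) ≤ 1 - 4 * δ := by linarith
  have h1 : 1 - 4 * δ < 1 := by linarith
  have hB : 0 ≤ B := by
    have := (abs_nonneg _).trans (h 0 le_rfl (by norm_num))
    exact nonneg_of_mul_nonneg_left this (Real.sqrt_pos.mpr (by linarith))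
  obtain ⟨hI, hle⟩ := integral_inv_mul_sqrt_le hδ
  have heq : ∑ j ∈ Finset.range q, c j * conjPoisson (1 - 4 * δ) (y j) =
      -∫ t in (0 : ℝ)..(1 / 2), conjPoissonDeriv (1 - 4 * δ) t *
        ∑ j ∈ Finset.range q, c j * arcSign t (y j) := by
    simp_rw [Finset.mul_sum]
    rw [intervalIntegral.integral_finsetSum, ← Finset.sum_neg_distrib]
    · refine Finset.sum_congr rfl fun j _ => ?_
      rw [conjPoisson_eq_neg_integral h0 h1, mul_neg, ← intervalIntegral.integral_const_mul]
      congr 2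
      ext t
      ring
    · intro j _
      refine ((intervalIntegrable_arcSign_mul h0 h1 (y j) 0 (1 / 2)).const_mul (c j)).congr ?_
      exact fun t _ => by ring
  rw [heq, abs_neg, ← Real.norm_eq_abs]
  refine (intervalIntegral.norm_integral_le_of_norm_le (by norm_num)
    (MeasureTheory.ae_of_all _ fun t ht => ?_) (hI.const_mul (30 * B))).trans ?_
  · have hp : 0 < t + δ := by linarith [ht.1]
    rw [norm_mul, Real.norm_eq_abs, Real.norm_eq_abs]
    calc _ ≤ 30 / (t + δ) ^ 2 * (B * √(t + δ)) :=
          mul_le_mul (abs_conjPoissonDeriv_le hδ hδ' ht.1.le ht.2) (h t ht.1.le ht.2)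
            (abs_nonneg _) (by positivity)
      _ = _ := by
          have hs := Real.sqrt_pos.mpr hp
          have hsq := Real.sq_sqrt hp.le
          field_simp
          rw [hsq]
          ring
  · rw [intervalIntegral.integral_const_mul]
    calc _ ≤ 30 * B * (2 / √δ) := mul_le_mul_of_nonneg_left hle (by positivity)
      _ = _ := by ring

end Kernel

/-! ### Continued fractions and the choice of good times -/

lemma exists_convergent_numerators {α : ℝ} (hα : Irrational α) :
    ∃ p : ℕ → ℤ, ∀ n, 0 < cfDen α n ∧ cfDen α n ≤ cfDen α (n + 1) ∧
      IsCoprime (p n) (cfDen α n) ∧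
      |α - p n / cfDen α n| ≤ 1 / ((cfDen α n : ℝ) * cfDen α (n + 1)) := by
  have hnt : ∀ n, ¬(GenContFract.of α).TerminatedAt n := by
    intro n hn
    obtain ⟨r, hr⟩ := (GenContFract.terminates_iff_rat α).mp ⟨n, hn⟩
    exact hα ⟨r, hr.symm⟩
  have key : ∀ m : ℕ, (∃ z : ℤ, ((GenContFract.of α).contsAux m).a = (z : ℝ)) ∧
      ∃ z : ℤ, ((GenContFract.of α).contsAux (m + 1)).a = (z : ℝ) := by
    intro m
    induction m with
    | zero => exact ⟨⟨1, by simp⟩, ⟨⌊α⌋, by simp⟩⟩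
    | succ m ih =>
      refine ⟨ih.2, ?_⟩
      obtain ⟨⟨u, hu⟩, ⟨v, hv⟩⟩ := ih
      rcases hs : (GenContFract.of α).s.get? m with _ | gp
      · exact absurd hs (hnt m)
      · obtain ⟨ha, z, hz⟩ :=
          GenContFract.of_partNum_eq_one_and_exists_int_partDen_eq hs
        refine ⟨z * v + u, ?_⟩
        rw [GenContFract.contsAux_recurrence hs rfl rfl]
        simp [ha, hz, hu, hv]
  choose p hp using fun n => (key n).2
  have hp' : ∀ n, (GenContFract.of α).nums n = p n := hp
  refine ⟨p, fun n => ?_⟩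
  have hfib : (Nat.fib (n + 1) : ℝ) ≤ (GenContFract.of α).dens n :=
    GenContFract.succ_nth_fib_le_of_nth_den (Or.inr (hnt _))
  have hpos : 0 < cfDen α n := by
    have h1 : (0 : ℝ) < Nat.fib (n + 1) := by exact_mod_cast Nat.fib_pos.mpr n.succ_pos
    have h2 : (0 : ℝ) < cfDen α n := by rw [cfDen_cast]; linarith
    exact_mod_cast h2
  refine ⟨hpos, ?_, ?_, ?_⟩
  · have h : (cfDen α n : ℝ) ≤ cfDen α (n + 1) := by
      rw [cfDen_cast, cfDen_cast]
      exact GenContFract.of_den_mono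
    exact_mod_cast h
  -- The determinant `±1` of two successive convergents is a Bézout relation.
  · have hdet := SimpContFract.determinant (s := SimpContFract.of α) (hnt n)
    have hdet' : (p n : ℝ) * cfDen α (n + 1) - cfDen α n * p (n + 1) = (-1) ^ (n + 1) := by
      rw [cfDen_cast, cfDen_cast, ← hp', ← hp']
      exact hdet
    have hdetZ : p n * cfDen α (n + 1) - cfDen α n * p (n + 1) = (-1) ^ (n + 1) := by
      exact_mod_cast hdet'
    rcases neg_one_pow_eq_or ℤ (n + 1) with h | h <;> rw [h] at hdetZ
    · exact ⟨cfDen α (n + 1), -p (n + 1), by linarith⟩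
    · exact ⟨-cfDen α (n + 1), p (n + 1), by linarith⟩
  · have h := GenContFract.abs_sub_convs_le (hnt n)
    rw [GenContFract.conv_eq_num_div_den, hp', ← cfDen_cast, ← cfDen_cast] at h
    exact h

lemma cfDen_zero (α : ℝ) : cfDen α 0 = 1 := by
  simp [cfDen, GenContFract.zeroth_den_eq_one]

/-- A real sequence bounded below by `1` has infinitely many terms which, up to a multiplicative
constant, dominate all their predecessors. -/
lemma exists_strictMono_forall_lt_le_mul {r : ℕ → ℝ} (hr : ∀ n, 1 ≤ r n) :
    ∃ K : ℝ, 1 ≤ K ∧ ∃ n : ℕ → ℕ, StrictMono n ∧ ∀ l, ∀ i < n l, r i ≤ K * r (n l) := by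
  by_cases hb : ∃ M, ∀ n, r n ≤ M
  · obtain ⟨M, hM⟩ := hb
    have hM1 : 1 ≤ M := (hr 0).trans (hM 0)
    refine ⟨M, hM1, id, strictMono_id, fun l i _ => (hM i).trans ?_⟩
    exact le_mul_of_one_le_right (by linarith) (hr _)
  · push Not at hb
    refine ⟨1, le_rfl, ?_⟩
    have hfreq : ∀ N, ∃ n ≥ N, ∀ i < n, r i ≤ 1 * r n := by
      intro N
      obtain ⟨M, hM⟩ : ∃ M, ∀ k ∈ Finset.range (N + 1), r k ≤ M :=
        ⟨∑ k ∈ Finset.range (N + 1), r k, fun k hk =>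
          Finset.single_le_sum (f := r) (fun i _ => by linarith [hr i]) hk⟩
      classical
      have hex := hb M
      -- `M` bounds the terms up to `N`. The first index exceeding `M` therefore lies beyond `N` and
      -- dominates everything before it.
      refine ⟨Nat.find hex, ?_, fun i hi => ?_⟩
      · by_contra hlt
        push Not at hlt
        have := hM (Nat.find hex) (Finset.mem_range.mpr (by omega))
        linarith [Nat.find_spec hex]
      · have := Nat.find_min hex hi
        linarith [Nat.find_spec hex]
    obtain ⟨n, hn, h⟩ := Filter.extraction_of_frequently_atTop (Filter.frequently_atTop.mpr hfreq)
    exact ⟨n, hn, h⟩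

/-- A denominator at the geometric mean scale between `1 / u` and `q n`. -/
lemma exists_le_div_add_mul_le {q : ℕ → ℕ} (hq0 : q 0 = 1) (hpos : ∀ l, 0 < q l) {n : ℕ}
    {R u : ℝ} (hR : 0 ≤ R) (hratio : ∀ l < n, (q (l + 1) : ℝ) ≤ R * q l)
    (hu : 1 / (8 * (q n : ℝ)) ≤ u) (hu1 : u ≤ 1) :
    ∃ l ≤ n, (q n : ℝ) / q l + q l * u ≤ (R + 4) * √(q n * u) := by
  have hQ : (0 : ℝ) < q n := by exact_mod_cast hpos n
  have hQ1 : (1 : ℝ) ≤ q n := by exact_mod_cast hpos n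
  have hu0 : 0 < u := lt_of_lt_of_le (by positivity) hu
  set s := √(q n * u) with hs
  have hs0 : 0 < s := Real.sqrt_pos.mpr (by positivity)
  have hs2 : s ^ 2 = q n * u := Real.sq_sqrt (by positivity)
  -- The lower bound on `u` enters here; it covers the case `l = n`, where the quotient is 1.
  have hs3 : 1 ≤ 3 * s := by
    rw [div_le_iff₀ (by positivity)] at hu
    nlinarith
  classical
  -- The last denominator at most `√(q n / u)`; index 0 always qualifies. If `l < n`, the next
  -- denominator exceeds this scale, so `q l` misses it by a factor at most `R`.
  obtain ⟨l, hldef⟩ : ∃ l, l = Nat.findGreatest (fun l => (q l : ℝ) * u ≤ s) n := ⟨_, rfl⟩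
  have hln : l ≤ n := hldef ▸ Nat.findGreatest_le n
  have hl : (q l : ℝ) * u ≤ s := by
    rw [hldef]
    refine Nat.findGreatest_spec (P := fun l => (q l : ℝ) * u ≤ s) (Nat.zero_le n) ?_
    rw [hq0, Nat.cast_one, one_mul]
    nlinarith
  refine ⟨l, hln, ?_⟩
  have hlpos : (0 : ℝ) < q l := by exact_mod_cast hpos l
  rcases hln.eq_or_lt with heq | hlt
  · rw [heq] at hl ⊢
    rw [div_self hQ.ne']
    nlinarith
  · have hnot : ¬ ((q (l + 1) : ℝ) * u ≤ s) :=
      Nat.findGreatest_is_greatest (P := fun l => (q l : ℝ) * u ≤ s) (hldef ▸ Nat.lt_succ_self l) hlt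
    push Not at hnot
    have h1 : (q n : ℝ) / q l ≤ R * s := by
      rw [div_le_iff₀ hlpos]
      have h2 : s < R * q l * u := hnot.trans_le (mul_le_mul_of_nonneg_right (hratio l hlt) hu0.le)
      have h3 : s * (q n) ≤ s * (R * s * q l) := by
        calc s * q n ≤ R * q l * u * q n := mul_le_mul_of_nonneg_right h2.le hQ.le
          _ = R * q l * s ^ 2 := by rw [hs2]; ring
          _ = s * (R * s * q l) := by ring
      exact le_of_mul_le_mul_left h3 hs0
    nlinarith

/-! ### Comparing the rotation by `α` with the one by `p n / q n` -/

/-- Data of the first convergents `p l / q l`, `l ≤ n`, of `α`, whose successive denominators grow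
at most by the factor `R`. -/
structure ConvergentData (α : ℝ) (p : ℕ → ℤ) (q : ℕ → ℕ) (n : ℕ) (R : ℝ) : Prop where
  den_zero : q 0 = 1
  den_pos : ∀ l, 0 < q l
  den_mono : ∀ l, q l ≤ q (l + 1)
  coprime : ∀ l, IsCoprime (p l) (q l)
  abs_sub_le_sq : ∀ l, |α - p l / q l| ≤ 1 / (q l : ℝ) ^ 2
  abs_sub_le : |α - p n / q n| ≤ 1 / ((q n : ℝ) * q (n + 1))
  R_nonneg : 0 ≤ R
  ratio : ∀ l < n, (q (l + 1) : ℝ) ≤ R * q l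

namespace ConvergentData

variable {α : ℝ} {p : ℕ → ℤ} {q : ℕ → ℕ} {n : ℕ} {R : ℝ}

/-- Each `t` uses its own denominator `q l`. Only proximity of `β` to the convergents matters, so
the bound holds along the whole segment from `p n / q n` to `α`. -/
lemma abs_sum_conjPoisson_le (h : ConvergentData α p q n R) {β : ℝ}
    (hβ : ∀ l ≤ n, |β - p l / q l| ≤ 2 / (q l : ℝ) ^ 2) (x : ℝ) :
    |∑ j ∈ Finset.range (q n), (j : ℝ) * conjPoisson (1 - 4 * (1 / (8 * (q n : ℝ)))) (x + j * β)|
      ≤ 3600 * (R + 7) * (q n : ℝ) ^ 2 := by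
  have hQ : (0 : ℝ) < q n := by exact_mod_cast h.den_pos n
  have hQ1 : (1 : ℝ) ≤ q n := by exact_mod_cast h.den_pos n
  set δ : ℝ := 1 / (8 * (q n : ℝ)) with hδ
  have hδ0 : 0 < δ := by positivity
  have hδ1 : δ ≤ 1 / 8 := by
    rw [hδ]
    gcongr
    linarith
  have hR := h.R_nonneg
  refine (abs_sum_mul_conjPoisson_le (B := 20 * q n * (R + 7) * √(q n)) hδ0 hδ1
    fun t ht0 ht => ?_).trans ?_
  · have hu : δ ≤ t + δ := by linarith
    obtain ⟨l, hl, hle⟩ := exists_le_div_add_mul_le h.den_zero h.den_pos hR h.ratio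
      hu (by linarith)
    refine (abs_sum_natCast_mul_arcSign_le (h.den_pos l) (h.coprime l) (hβ l hl) ht0
      (by linarith) x).trans ?_
    have h1 : 1 ≤ 3 * √(q n * (t + δ)) := by
      have h2 : (1 / 3) ^ 2 ≤ (q n : ℝ) * (t + δ) := by
        have : (q n : ℝ) * δ = 1 / 8 := by rw [hδ]; field_simp
        nlinarith [mul_nonneg hQ.le ht0]
      have := Real.le_sqrt_of_sq_le h2
      linarith
    have h3 : (q l : ℝ) * t ≤ q l * (t + δ) :=
      mul_le_mul_of_nonneg_left (by linarith) (Nat.cast_nonneg _)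
    have h4 : (q n : ℝ) / q l + q l * t + 1 ≤ (R + 7) * √(q n * (t + δ)) := by linarith
    calc 20 * (q n : ℝ) * (q n / q l + q l * t + 1)
        ≤ 20 * q n * ((R + 7) * √(q n * (t + δ))) := by gcongr
      _ = _ := by
        rw [Real.sqrt_mul hQ.le]
        ring
  · have h5 : √(q n : ℝ) / √δ ≤ 3 * q n := by
      rw [← Real.sqrt_div hQ.le, Real.sqrt_le_left (by positivity)]
      rw [hδ]
      field_simp
      norm_num
    calc 60 * (20 * (q n : ℝ) * (R + 7) * √(q n)) / √δ
        = 1200 * q n * (R + 7) * (√(q n : ℝ) / √δ) := by ring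
      _ ≤ 1200 * q n * (R + 7) * (3 * q n) := by gcongr
      _ = _ := by ring

/-- Mean value inequality in the rotation angle: the `j`-th point moves at speed `j * θ` with `θ = α
- p n / q n`, whence the weight `j` in the kernel sum. -/
lemma sum_log_normSqOneSub_le (h : ConvergentData α p q n R) (x : ℝ) :
    ∑ j ∈ Finset.range (q n),
        Real.log (normSqOneSub (1 - 4 * (1 / (8 * (q n : ℝ)))) (x + j * α)) / 2 ≤
      ∑ j ∈ Finset.range (q n),
        Real.log (normSqOneSub (1 - 4 * (1 / (8 * (q n : ℝ)))) (x + j * (p n / q n))) / 2 +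
      3600 * (R + 7) * q n / q (n + 1) := by
  have hQ : (0 : ℝ) < q n := by exact_mod_cast h.den_pos n
  have hQ1 : (1 : ℝ) ≤ q n := by exact_mod_cast h.den_pos n
  have hQ' : (0 : ℝ) < q (n + 1) := by exact_mod_cast h.den_pos (n + 1)
  have hr : 4 * (1 / (8 * (q n : ℝ))) ≤ 1 := by
    rw [mul_one_div, div_le_one (by positivity)]
    linarith
  have hr' : 0 < 4 * (1 / (8 * (q n : ℝ))) := by positivity
  set r : ℝ := 1 - 4 * (1 / (8 * (q n : ℝ))) with hrdef
  set θ : ℝ := α - p n / q n with hθ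
  let G : ℝ → ℝ := fun s =>
    ∑ j ∈ Finset.range (q n), Real.log (normSqOneSub r (x + j * (p n / q n + s * θ))) / 2
  let G' : ℝ → ℝ := fun s =>
    θ * ∑ j ∈ Finset.range (q n), (j : ℝ) * conjPoisson r (x + j * (p n / q n + s * θ))
  have hG : ∀ s, HasDerivAt G (G' s) s := by
    intro s
    have hj : ∀ j ∈ Finset.range (q n), HasDerivAt
        (fun s : ℝ => Real.log (normSqOneSub r (x + j * (p n / q n + s * θ))) / 2)
        (conjPoisson r (x + j * (p n / q n + s * θ)) * (j * θ)) s := by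
      intro j _
      have hin : HasDerivAt (fun s : ℝ => x + j * (p n / q n + s * θ)) (j * θ) s := by
        have := ((((hasDerivAt_id s).mul_const θ).const_add ((p n : ℝ) / q n)).const_mul
          (j : ℝ)).const_add x
        exact this.congr_deriv (by ring)
      exact (hasDerivAt_log_normSqOneSub (by linarith) (by linarith) _).comp s hin
    refine (HasDerivAt.fun_sum hj).congr_deriv ?_
    simp only [G', Finset.mul_sum]
    exact Finset.sum_congr rfl fun j _ => by ring
  have hbound : ∀ s ∈ Set.Icc (0 : ℝ) 1, ‖G' s‖ ≤ 3600 * (R + 7) * q n / q (n + 1) := by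
    intro s hs
    -- Since `|θ| ≤ 1 / q_n² ≤ 1 / q_l²`, intermediate angles at most double the bound on the
    -- distance to `p l / q l`.
    have hβ : ∀ l ≤ n, |(p n / q n + s * θ) - p l / q l| ≤ 2 / (q l : ℝ) ^ 2 := by
      intro l hl
      have hql : (0 : ℝ) < q l := by exact_mod_cast h.den_pos l
      have hle : (q l : ℝ) ≤ q n := by exact_mod_cast monotone_nat_of_le_succ h.den_mono hl
      have hn := h.abs_sub_le_sq n
      have hnl : 1 / (q n : ℝ) ^ 2 ≤ 1 / (q l : ℝ) ^ 2 := by gcongr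
      have hs' : |(1 - s) * θ| ≤ |θ| := by
        rw [abs_mul]
        refine mul_le_of_le_one_left (abs_nonneg _) (abs_le.mpr ⟨?_, ?_⟩) <;>
          linarith [hs.1, hs.2]
      calc |(p n / q n + s * θ) - p l / q l| = |(α - p l / q l) - (1 - s) * θ| := by
            congr 1
            rw [hθ]
            ring
        _ ≤ |α - p l / q l| + |(1 - s) * θ| := abs_sub _ _
        _ ≤ 1 / (q l : ℝ) ^ 2 + 1 / (q l : ℝ) ^ 2 :=
            add_le_add (h.abs_sub_le_sq l) ((hs'.trans hn).trans hnl)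
        _ = _ := by ring
    rw [Real.norm_eq_abs, abs_mul]
    calc |θ| * _ ≤ 1 / ((q n : ℝ) * q (n + 1)) * (3600 * (R + 7) * (q n : ℝ) ^ 2) :=
          mul_le_mul h.abs_sub_le (h.abs_sum_conjPoisson_le hβ x) (abs_nonneg _) (by positivity)
      _ = _ := by field_simp
  have hmv := (convex_Icc (0 : ℝ) 1).norm_image_sub_le_of_norm_hasDerivWithin_le
    (fun s _ => (hG s).hasDerivWithinAt) hbound (Set.left_mem_Icc.mpr zero_le_one)
    (Set.right_mem_Icc.mpr zero_le_one)
  have h1 := (Real.le_norm_self _).trans hmv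
  simp only [G, zero_mul, add_zero, sub_zero, norm_one, mul_one, one_mul, hθ,
    add_sub_cancel] at h1
  linarith

end ConvergentData

/-! ### The model singularity and roots of unity -/

/-- The point `e^{2πix}` of the unit circle. -/
noncomputable def unitExp (x : ℝ) : ℂ := circleMap 0 1 (2 * Real.pi * x)

lemma unitExp_eq_exp (x : ℝ) : unitExp x = Complex.exp (2 * Real.pi * x * Complex.I) := by
  simp [unitExp, circleMap]

lemma norm_unitExp (x : ℝ) : ‖unitExp x‖ = 1 := by
  simp [unitExp]

lemma unitExp_mem_sphere (x : ℝ) : unitExp x ∈ Metric.sphere (0 : ℂ) 1 := by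
  simp [norm_unitExp]

lemma unitExp_add (x y : ℝ) : unitExp (x + y) = unitExp x * unitExp y := by
  simp only [unitExp_eq_exp, ← Complex.exp_add]
  congr 1
  push_cast
  ring

lemma unitExp_natCast_mul (j : ℕ) (y : ℝ) : unitExp (j * y) = unitExp y ^ j := by
  simp only [unitExp_eq_exp, ← Complex.exp_nat_mul]
  congr 1
  push_cast
  ring

lemma periodic_unitExp : Function.Periodic unitExp 1 := by
  intro x
  rw [unitExp_add]
  have : unitExp 1 = 1 := by
    rw [unitExp_eq_exp]
    simp [Complex.exp_two_pi_mul_I]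
  rw [this, mul_one]

lemma exists_unitExp_eq {u : ℂ} (hu : ‖u‖ = 1) : ∃ a : ℝ, unitExp a = u := by
  refine ⟨u.arg / (2 * Real.pi), ?_⟩
  have h := Complex.norm_mul_exp_arg_mul_I u
  rw [hu, Complex.ofReal_one, one_mul] at h
  rw [← h, unitExp_eq_exp]
  congr 2
  have : (Real.pi : ℂ) ≠ 0 := by exact_mod_cast Real.pi_ne_zero
  push_cast
  rw [Complex.arg_exp_mul_I]
  have h2 : toIocMod Real.two_pi_pos (-Real.pi) u.arg = u.arg := by
    rw [toIocMod_eq_self]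
    have := Complex.arg_mem_Ioc u
    constructor
    · exact this.1
    · linarith [this.2]
  rw [h2]
  field_simp

lemma normSqOneSub_eq_norm_sq (r x : ℝ) : normSqOneSub r x = ‖1 - r * unitExp x‖ ^ 2 := by
  have hexp : unitExp x = Complex.exp ((2 * Real.pi * x : ℝ) * Complex.I) := by
    simp [unitExp_eq_exp]
  have hre : (1 - r * unitExp x).re = 1 - r * Real.cos (2 * Real.pi * x) := by
    rw [hexp]
    simp [Complex.exp_ofReal_mul_I_re, -Complex.ofReal_mul]
  have him : (1 - r * unitExp x).im = -(r * Real.sin (2 * Real.pi * x)) := by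
    rw [hexp]
    simp [Complex.exp_ofReal_mul_I_im, -Complex.ofReal_mul]
  rw [← Complex.normSq_eq_norm_sq, Complex.normSq_apply, hre, him, normSqOneSub]
  have := Real.sin_sq_add_cos_sq (2 * Real.pi * x)
  linear_combination (-r ^ 2) * this

lemma isPrimitiveRoot_unitExp {p : ℤ} {q : ℕ} (hq : 0 < q) (hpq : IsCoprime p q) :
    IsPrimitiveRoot (unitExp (p / q)) q := by
  have h := Complex.isPrimitiveRoot_exp_of_isCoprime p q hq.ne' hpq
  convert h using 1
  rw [unitExp_eq_exp]
  congr 1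
  push_cast
  ring

lemma IsPrimitiveRoot.image_pow_range_eq_nthRootsFinset {ζ : ℂ} {q : ℕ}
    (hζ : IsPrimitiveRoot ζ q) (hq : 0 < q) :
    (Finset.range q).image (fun j => ζ ^ j) = Polynomial.nthRootsFinset q (1 : ℂ) := by
  refine Finset.eq_of_subset_of_card_le ?_ ?_
  · intro z hz
    obtain ⟨j, _, rfl⟩ := Finset.mem_image.mp hz
    rw [Polynomial.mem_nthRootsFinset hq, ← pow_mul, mul_comm, pow_mul, hζ.pow_eq_one, one_pow]
  · rw [hζ.card_nthRootsFinset, Finset.card_image_of_injOn, Finset.card_range]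
    intro i hi j hj hij
    exact hζ.pow_inj (by simpa using hi) (by simpa using hj) hij

lemma IsPrimitiveRoot.sum_range_pow {ζ : ℂ} {q : ℕ} (hζ : IsPrimitiveRoot ζ q) (hq : 0 < q)
    {M : Type*} [AddCommMonoid M] (f : ℂ → M) :
    ∑ j ∈ Finset.range q, f (ζ ^ j) = ∑ z ∈ Polynomial.nthRootsFinset q (1 : ℂ), f z := by
  rw [← hζ.image_pow_range_eq_nthRootsFinset hq, Finset.sum_image]
  intro i hi j hj hij
  exact hζ.pow_inj (by simpa using hi) (by simpa using hj) hij

/-- The orbit runs through all `q`-th roots of unity `w`, and `∏ (1 - w z) = 1 - z ^ q` with `|z| <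
1`. -/
lemma sum_log_normSqOneSub_rational_le {r : ℝ} (h0 : 0 ≤ r) (h1 : r < 1) {p : ℤ} {q : ℕ}
    (hq : 0 < q) (hpq : IsCoprime p q) (x : ℝ) :
    ∑ j ∈ Finset.range q, Real.log (normSqOneSub r (x + j * (p / q))) / 2 ≤ Real.log 2 := by
  have hζ := isPrimitiveRoot_unitExp hq hpq
  have hz : ‖(r : ℂ) * unitExp x‖ = r := by
    rw [norm_mul, norm_unitExp, mul_one, Complex.norm_real, Real.norm_of_nonneg h0]
  set z : ℂ := r * unitExp x with hzdef
  have hterm : ∀ j ∈ Finset.range q, Real.log (normSqOneSub r (x + j * (p / q))) / 2 =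
      Real.log ‖1 - unitExp (p / q) ^ j * z‖ := by
    intro j _
    rw [normSqOneSub_eq_norm_sq, Real.log_pow, unitExp_add, unitExp_natCast_mul, hzdef]
    push_cast
    rw [mul_div_cancel_left₀ _ two_ne_zero]
    congr 3
    ring
  have hne : ∀ w ∈ Polynomial.nthRootsFinset q (1 : ℂ), ‖1 - w * z‖ ≠ 0 := by
    intro w hw h
    rw [norm_eq_zero, sub_eq_zero] at h
    have hw1 : ‖w‖ = 1 :=
      Complex.norm_eq_one_of_pow_eq_one ((Polynomial.mem_nthRootsFinset hq _).mp hw) hq.ne'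
    have := congrArg norm h
    rw [norm_mul, hw1, hz, norm_one] at this
    linarith
  rw [Finset.sum_congr rfl hterm,
    hζ.sum_range_pow hq (fun w => Real.log ‖1 - w * z‖), ← Real.log_prod hne, ← norm_prod,
    ← hζ.pow_sub_pow_eq_prod_sub_mul 1 z hq, one_pow]
  have hzq : ‖z ^ q‖ < 1 := by
    rw [norm_pow, hz]
    exact pow_lt_one₀ h0 h1 hq.ne'
  refine Real.log_le_log ?_ ((norm_sub_le _ _).trans ?_)
  · rw [norm_pos_iff, sub_ne_zero]
    intro h
    rw [← h, norm_one] at hzq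
    exact lt_irrefl _ hzq
  · rw [norm_one]
    linarith

/-- From `|1 - r e|² = (1 - r)² + r |1 - e|²` for `|e| = 1`. -/
lemma log_norm_one_sub_unitExp_le {r x : ℝ} (h0 : 0 < r) (hx : unitExp x ≠ 1) :
    Real.log ‖1 - unitExp x‖ ≤ Real.log (normSqOneSub r x) / 2 - Real.log r / 2 := by
  have hpos : 0 < ‖1 - unitExp x‖ := norm_pos_iff.mpr (sub_ne_zero.mpr (Ne.symm hx))
  have hsq : normSqOneSub 1 x = ‖1 - unitExp x‖ ^ 2 := by simp [normSqOneSub_eq_norm_sq]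
  have hle : r * ‖1 - unitExp x‖ ^ 2 ≤ normSqOneSub r x := by
    rw [← hsq]
    unfold normSqOneSub
    nlinarith [sq_nonneg (1 - r)]
  have h := Real.log_le_log (by positivity) hle
  rw [Real.log_mul h0.ne' (by positivity), Real.log_pow] at h
  push_cast at h
  linarith

lemma ConvergentData.sum_log_norm_one_sub_unitExp_le {α : ℝ} {p : ℕ → ℤ} {q : ℕ → ℕ} {n : ℕ}
    {R : ℝ} (h : ConvergentData α p q n R) {x : ℝ}
    (hx : ∀ j ∈ Finset.range (q n), unitExp (x + j * α) ≠ 1) :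
    ∑ j ∈ Finset.range (q n), Real.log ‖1 - unitExp (x + j * α)‖ ≤
      2 * Real.log 2 + 3600 * (R + 7) * q n / q (n + 1) := by
  have hQ : (0 : ℝ) < q n := by exact_mod_cast h.den_pos n
  have hQ1 : (1 : ℝ) ≤ q n := by exact_mod_cast h.den_pos n
  have hr : 4 * (1 / (8 * (q n : ℝ))) ≤ 1 / 2 := by
    rw [mul_one_div, div_le_div_iff₀ (by positivity) (by norm_num)]
    linarith
  have hr' : 0 < 4 * (1 / (8 * (q n : ℝ))) := by positivity
  have hsum := h.sum_log_normSqOneSub_le x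
  -- By Bernoulli, `(1 - 1/(2q))^q ≥ 1/2`: regularizing all `q` terms costs at most `log 2 / 2`.
  have hrq : (1 / 2 : ℝ) ≤ (1 - 4 * (1 / (8 * (q n : ℝ)))) ^ (q n) := by
    have := one_add_mul_le_pow (a := -(4 * (1 / (8 * (q n : ℝ))))) (by linarith) (q n)
    rw [← sub_eq_add_neg] at this
    refine le_trans (le_of_eq ?_) this
    field_simp
    norm_num
  set r : ℝ := 1 - 4 * (1 / (8 * (q n : ℝ))) with hrdef
  have hr0 : 0 < r := by linarith
  have hr1 : r < 1 := by linarith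
  have hrat := sum_log_normSqOneSub_rational_le hr0.le hr1 (h.den_pos n) (h.coprime n) x
  have hlog : -Real.log 2 ≤ q n * Real.log r := by
    rw [← Real.log_pow, ← Real.log_inv]
    exact Real.log_le_log (by norm_num) (by simpa using hrq)
  have hlog2 : 0 ≤ Real.log 2 := Real.log_nonneg (by norm_num)
  calc ∑ j ∈ Finset.range (q n), Real.log ‖1 - unitExp (x + j * α)‖
      ≤ ∑ j ∈ Finset.range (q n),
          (Real.log (normSqOneSub r (x + j * α)) / 2 - Real.log r / 2) :=
        Finset.sum_le_sum fun j hj => log_norm_one_sub_unitExp_le hr0 (hx j hj)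
    _ = ∑ j ∈ Finset.range (q n), Real.log (normSqOneSub r (x + j * α)) / 2 -
          q n * Real.log r / 2 := by
        rw [Finset.sum_sub_distrib, Finset.sum_const, Finset.card_range, nsmul_eq_mul]
        ring
    _ ≤ _ := by linarith

/-! ### The zero-free factor and the factorization -/

/-- Denjoy--Koksma inequality for Lipschitz functions. -/
lemma sum_lipschitz_le_mul_integral_add {φ : ℂ → ℝ} {L : NNReal}
    (hL : LipschitzWith L (fun x => φ (unitExp x))) {α : ℝ} {p : ℤ} {q : ℕ} (hq : 0 < q)
    (hpq : IsCoprime p q) (hα : |α - p / q| ≤ 1 / (q : ℝ) ^ 2) (x : ℝ) :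
    ∑ j ∈ Finset.range q, φ (unitExp (x + j * α)) ≤
      q * (∫ t in (0 : ℝ)..1, φ (unitExp t)) + 2 * L := by
  have hQ : (0 : ℝ) < q := by exact_mod_cast hq
  have hLip : ∀ a b, φ (unitExp a) ≤ φ (unitExp b) + L * |a - b| := by
    intro a b
    have := hL.dist_le_mul a b
    rw [Real.dist_eq, Real.dist_eq] at this
    linarith [le_abs_self (φ (unitExp a) - φ (unitExp b))]
  -- Each of the `q` points moves by at most `1 / q`, a total cost of `L`.
  have hrot : ∑ j ∈ Finset.range q, φ (unitExp (x + j * α)) ≤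
      ∑ j ∈ Finset.range q, φ (unitExp (x + j * (p / q))) + L := by
    calc _ ≤ ∑ j ∈ Finset.range q, (φ (unitExp (x + j * (p / q))) + L * (1 / q)) := by
          refine Finset.sum_le_sum fun j hj => (hLip _ (x + j * (p / q))).trans ?_
          gcongr
          rw [show x + j * α - (x + j * (p / q)) = j * (α - p / q) by ring, abs_mul, Nat.abs_cast]
          have hjq : (j : ℝ) ≤ q := by exact_mod_cast (Finset.mem_range.mp hj).le
          calc (j : ℝ) * |α - p / q| ≤ q * (1 / (q : ℝ) ^ 2) := by gcongr
            _ = 1 / q := by field_simp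
      _ = _ := by
          rw [Finset.sum_add_distrib, Finset.sum_const, Finset.card_range, nsmul_eq_mul,
            mul_left_comm, mul_one_div_cancel hQ.ne', mul_one]
  -- Both sides enumerate the `q`-th roots of unity, so the orbit becomes an equally spaced grid.
  have hperm : ∑ j ∈ Finset.range q, φ (unitExp (x + j * (p / q))) =
      ∑ k ∈ Finset.range q, φ (unitExp (x + k * (1 / q))) := by
    have h1 := (isPrimitiveRoot_unitExp hq hpq).sum_range_pow hq (fun w => φ (unitExp x * w))
    have h2 := (isPrimitiveRoot_unitExp (p := 1) hq isCoprime_one_left).sum_range_pow hq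
      (fun w => φ (unitExp x * w))
    simp only [unitExp_add, unitExp_natCast_mul]
    rw [h1, ← h2]
    simp
  have hcont : Continuous (fun x => φ (unitExp x)) := hL.continuous
  have hcell : ∀ k : ℕ, φ (unitExp (x + k * (1 / q))) ≤
      q * (∫ t in (x + k * (1 / q))..(x + (k + 1 : ℕ) * (1 / q)), φ (unitExp t)) + L / q := by
    intro k
    have hab : x + k * (1 / q : ℝ) ≤ x + (k + 1 : ℕ) * (1 / q) := by
      gcongr
      exact k.le_succ
    have hlen : x + (k + 1 : ℕ) * (1 / q : ℝ) - (x + k * (1 / q)) = 1 / q := by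
      push_cast
      ring
    have hint := intervalIntegral.integral_mono_on (μ := MeasureTheory.volume)
      (f := fun _ => φ (unitExp (x + k * (1 / q))) - L / q)
      (g := fun t => φ (unitExp t)) hab (by simp) (hcont.intervalIntegrable _ _) ?_
    · rw [intervalIntegral.integral_const, hlen, smul_eq_mul] at hint
      have := mul_le_mul_of_nonneg_left hint hQ.le
      rw [← mul_assoc, mul_one_div_cancel hQ.ne', one_mul] at this
      linarith
    · intro t ht
      have h1 := hLip (x + k * (1 / q)) t
      have h2 : |x + k * (1 / q) - t| ≤ 1 / q := by
        rw [abs_le]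
        constructor <;> linarith [ht.1, ht.2]
      have h3 : (L : ℝ) * |x + k * (1 / q) - t| ≤ L / q :=
        (mul_le_mul_of_nonneg_left h2 L.coe_nonneg).trans_eq (mul_one_div _ _)
      linarith
  have hsum : ∑ k ∈ Finset.range q, φ (unitExp (x + k * (1 / q))) ≤
      q * (∫ t in (0 : ℝ)..1, φ (unitExp t)) + L := by
    refine (Finset.sum_le_sum fun k _ => hcell k).trans (le_of_eq ?_)
    rw [Finset.sum_add_distrib, ← Finset.mul_sum,
      intervalIntegral.sum_integral_adjacent_intervals
        (a := fun k : ℕ => x + k * (1 / q : ℝ)) fun k _ => hcont.intervalIntegrable _ _,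
      Finset.sum_const, Finset.card_range, nsmul_eq_mul]
    have hper : Function.Periodic (fun t => φ (unitExp t)) 1 := fun t => by
      simp only [periodic_unitExp t]
    have := hper.intervalIntegral_add_eq x 0
    rw [zero_add] at this
    rw [Nat.cast_zero, zero_mul, add_zero, mul_one_div_cancel hQ.ne', this,
      mul_div_cancel₀ _ hQ.ne']
  linarith

/-- A function analytic near the unit circle and not vanishing identically on it is the product of
finitely many linear factors with zeros on the circle and of an analytic function without zeros. -/
lemma exists_eq_prod_sub_pow_mul {φ : ℂ → ℂ} (hφ : AnalyticOnNhd ℂ φ (Metric.sphere 0 1))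
    (hne : ∃ z ∈ Metric.sphere (0 : ℂ) 1, φ z ≠ 0) :
    ∃ (s : Finset ℂ) (m : ℂ → ℕ) (g : ℂ → ℂ),
      (∀ u ∈ s, ‖u‖ = 1) ∧ (∀ u ∈ s, m u ≠ 0) ∧ AnalyticOnNhd ℂ g (Metric.sphere 0 1) ∧
      (∀ z ∈ Metric.sphere (0 : ℂ) 1, g z ≠ 0) ∧
      ∀ z ∈ Metric.sphere (0 : ℂ) 1, φ z = (∏ u ∈ s, (z - u) ^ m u) * g z := by
  set U : Set ℂ := Metric.sphere 0 1 with hU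
  have hrank : 1 < Module.rank ℝ ℂ := Complex.rank_real_complex ▸ Nat.one_lt_ofNat
  have hconn : IsConnected U := isConnected_sphere hrank 0 zero_le_one
  have hpre : Preperfect U := by
    refine hconn.isPreconnected.preperfect_of_nontrivial ⟨1, by simp [hU], -1, by simp [hU], ?_⟩
    norm_num
  -- A zero of infinite order would, the circle being connected, force `φ` to vanish identically on
  -- it.
  have hord : ∀ u ∈ U, meromorphicOrderAt φ u ≠ ⊤ := by
    refine (hφ.meromorphicOn.exists_meromorphicOrderAt_ne_top_iff_forall_mem hconn).mp ?_
    obtain ⟨z, hz, hz0⟩ := hne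
    refine ⟨z, hz, ?_⟩
    rw [(hφ z hz).meromorphicNFAt.meromorphicOrderAt_eq_zero_iff.mpr hz0]
    exact WithTop.zero_ne_top
  have hfin : (MeromorphicOn.divisor φ U).support.Finite := divisor_sphere_support_finite
  obtain ⟨g, hg, hg0, heq⟩ := hφ.meromorphicOn.extract_zeros_poles (fun u => hord u u.2) hfin
  have hnn : ∀ u, 0 ≤ MeromorphicOn.divisor φ U u := MeromorphicOn.AnalyticOnNhd.divisor_nonneg hφ
  have hprod : (∏ᶠ u, (· - u) ^ MeromorphicOn.divisor φ U u : ℂ → ℂ) =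
      fun z => ∏ u ∈ hfin.toFinset, (z - u) ^ (MeromorphicOn.divisor φ U u).toNat := by
    rw [finprod_eq_prod_of_mulSupport_subset (s := hfin.toFinset) _
      (by simp [Function.FactorizedRational.mulSupport])]
    ext z
    rw [Finset.prod_apply]
    refine Finset.prod_congr rfl fun u _ => ?_
    rw [Pi.pow_apply]
    conv_lhs => rw [← Int.toNat_of_nonneg (hnn u)]
    rw [zpow_natCast]
  rw [hprod] at heq
  refine ⟨hfin.toFinset, fun u => (MeromorphicOn.divisor φ U u).toNat, g, ?_, ?_, hg,
    fun z hz => hg0 ⟨z, hz⟩, ?_⟩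
  · intro u hu
    have := (MeromorphicOn.divisor φ U).supportWithinDomain (hfin.mem_toFinset.mp hu)
    simpa [hU] using this
  · intro u hu h0
    have h1 := hfin.mem_toFinset.mp hu
    have h2 := hnn u
    rw [Function.mem_support] at h1
    simp only at h0
    omega
  · intro z hz
    have han : AnalyticAt ℂ ((fun z => ∏ u ∈ hfin.toFinset,
        (z - u) ^ (MeromorphicOn.divisor φ U u).toNat) • g) z := by
      refine AnalyticAt.smul ?_ (hg z hz)
      fun_prop
    -- The factorization is given only off a discrete set; as the circle has no isolated points,
    -- continuity extends it to the zeros themselves.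
    have hev := (hφ z hz).meromorphicAt.eventuallyEq_nhdsNE_of_eventuallyEq_codiscreteWithin_preperfect
      han.meromorphicAt hz hpre heq
    have := ((hφ z hz).continuousAt.eventuallyEq_nhds_iff_eventuallyEq_nhdsNE
      han.continuousAt).mp hev
    simpa using this.eq_of_nhds

lemma contDiff_unitExp : ContDiff ℝ 1 unitExp := by
  have : unitExp = fun x : ℝ => Complex.exp (2 * Real.pi * x * Complex.I) :=
    funext unitExp_eq_exp
  rw [this]
  have h : ContDiff ℝ 1 (fun x : ℝ => (x : ℂ)) := Complex.ofRealCLM.contDiff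
  fun_prop

/-- A periodic `C¹` function has bounded derivative. -/
lemma exists_lipschitzWith_log_norm {g : ℂ → ℂ} (hg : AnalyticOnNhd ℂ g (Metric.sphere 0 1))
    (hg0 : ∀ z ∈ Metric.sphere (0 : ℂ) 1, g z ≠ 0) :
    ∃ L : NNReal, LipschitzWith L (fun x : ℝ => Real.log ‖g (unitExp x)‖) := by
  set ψ : ℝ → ℝ := fun x => Real.log ‖g (unitExp x)‖ with hψ
  have hdiff : ContDiff ℝ 1 ψ := by
    rw [contDiff_iff_contDiffAt]
    intro x
    have hx := unitExp_mem_sphere x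
    have h1 : ContDiffAt ℝ 1 g (unitExp x) := (hg _ hx).contDiffAt.restrict_scalars ℝ
    have h2 : ContDiffAt ℝ 1 (fun x => g (unitExp x)) x :=
      h1.comp x contDiff_unitExp.contDiffAt
    exact (h2.norm ℝ (hg0 _ hx)).log (norm_ne_zero_iff.mpr (hg0 _ hx))
  have hper : Function.Periodic ψ 1 := fun x => by
    simp only [hψ, periodic_unitExp x]
  have hper' : Function.Periodic (deriv ψ) 1 := fun x => by
    rw [← deriv_comp_add_const]
    congr 1
    exact funext hper
  obtain ⟨M, hM⟩ := isBounded_iff_forall_norm_le.mp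
    (hper'.isBounded_of_continuous one_ne_zero (hdiff.continuous_deriv le_rfl))
  have hM0 : 0 ≤ M := (norm_nonneg _).trans (hM _ ⟨0, rfl⟩)
  refine ⟨⟨M, hM0⟩, lipschitzWith_of_nnnorm_deriv_le (hdiff.differentiable one_ne_zero)
    fun x => hM _ ⟨x, rfl⟩⟩

/-! ### Means, integrability and passage to the unit circle -/

lemma integral_comp_unitExp (h : ℂ → ℝ) :
    ∫ t in (0 : ℝ)..1, h (unitExp t) = Real.circleAverage h 0 1 := by
  unfold unitExp Real.circleAverage
  rw [intervalIntegral.integral_comp_mul_left (fun t => h (circleMap 0 1 t))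
    (by positivity : 2 * Real.pi ≠ 0)]
  simp

/-- By Jensen's formula `log |z - u|` has mean zero when `|u| = 1`, so the zeros do not affect the
mean. -/
lemma circleAverage_log_norm_eq {φ g : ℂ → ℂ} {s : Finset ℂ} {m : ℂ → ℕ}
    (hs : ∀ u ∈ s, ‖u‖ = 1) (hg : AnalyticOnNhd ℂ g (Metric.sphere 0 1))
    (hg0 : ∀ z ∈ Metric.sphere (0 : ℂ) 1, g z ≠ 0)
    (heq : ∀ z ∈ Metric.sphere (0 : ℂ) 1, φ z = (∏ u ∈ s, (z - u) ^ m u) * g z) :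
    Real.circleAverage (fun z => Real.log ‖φ z‖) 0 1 =
      Real.circleAverage (fun z => Real.log ‖g z‖) 0 1 := by
  have hint : ∀ u, CircleIntegrable (fun z => (m u : ℝ) * Real.log ‖z - u‖) 0 1 := fun u =>
    IntervalIntegrable.const_mul (circleIntegrable_log_norm_sub_const (a := u) (c := 0) 1) _
  have hintg : CircleIntegrable (fun z => Real.log ‖g z‖) 0 1 :=
    MeromorphicOn.circleIntegrable_log_norm (by simpa using hg.meromorphicOn)
  have hints : CircleIntegrable (∑ u ∈ s, fun z => (m u : ℝ) * Real.log ‖z - u‖) 0 1 :=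
    CircleIntegrable.sum s fun u _ => hint u
  have hcongr : (fun z => Real.log ‖φ z‖) =ᶠ[Filter.codiscreteWithin (Metric.sphere 0 |1|)]
      (∑ u ∈ s, fun z => (m u : ℝ) * Real.log ‖z - u‖) + fun z => Real.log ‖g z‖ := by
    filter_upwards [compl_finite_mem_codiscreteWithin s.finite_toSet, Filter.self_mem_codiscreteWithin _]
      with z hz hzU
    rw [abs_one] at hzU
    rw [heq z hzU, Pi.add_apply, Finset.sum_apply, norm_mul, norm_prod, Real.log_mul, Real.log_prod]
    · simp [Real.log_pow]
    · intro u hu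
      have : z ≠ u := fun h => hz (h ▸ hu)
      simp [sub_ne_zero.mpr this]
    · rw [Finset.prod_ne_zero_iff]
      intro u hu
      have : z ≠ u := fun h => hz (h ▸ hu)
      simp [sub_ne_zero.mpr this]
    · simpa using hg0 z hzU
  rw [Real.circleAverage_congr_codiscreteWithin hcongr one_ne_zero,
    Real.circleAverage_add hints hintg, Real.circleAverage_sum fun u _ => hint u,
    Finset.sum_eq_zero, zero_add]
  intro u hu
  have h1 : Real.circleAverage (fun z => (m u : ℝ) • Real.log ‖z - u‖) 0 1 =
      (m u : ℝ) • Real.circleAverage (fun z => Real.log ‖z - u‖) 0 1 :=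
    Real.circleAverage_fun_smul
  simp only [smul_eq_mul] at h1
  rw [h1, circleAverage_log_norm_sub_const_of_mem_closedBall (by simp [hs u hu])]
  simp

lemma AnalyticNearCircle.exists_analyticOnNhd {f : UnitAddCircle → ℂ}
    (hf : AnalyticNearCircle f) :
    ∃ φ : ℂ → ℂ, AnalyticOnNhd ℂ φ (Metric.sphere 0 1) ∧
      ∀ t : ℝ, f (t : UnitAddCircle) = φ (unitExp t) := by
  classical
  obtain ⟨ε, hε, F, hF, hper, hfF⟩ := hf
  -- Extension by zero makes periodicity global, as `cuspFunction` needs; near the unit circle only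
  -- values inside the strip occur.
  let F' : ℂ → ℂ := fun z => if |z.im| < ε then F z else 0
  have hper' : Function.Periodic F' ((1 : ℝ) : ℂ) := by
    intro z
    simp only [F', Complex.ofReal_one, Complex.add_im, Complex.one_im, add_zero]
    split_ifs with h
    · exact hper z h
    · rfl
  have hopen : IsOpen {z : ℂ | |z.im| < ε} :=
    isOpen_lt (continuous_abs.comp Complex.continuous_im) continuous_const
  have hdiff : ∀ z : ℂ, |z.im| < ε → DifferentiableAt ℂ F' z := by
    intro z hz
    refine (hF.differentiableAt (hopen.mem_nhds hz)).congr_of_eventuallyEq ?_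
    filter_upwards [hopen.mem_nhds hz] with w hw
    exact if_pos hw
  have hunit : ∀ t : ℝ, unitExp t = Function.Periodic.qParam 1 (t : ℂ) := by
    intro t
    rw [unitExp_eq_exp, Function.Periodic.qParam]
    congr 1
    push_cast
    ring
  refine ⟨Function.Periodic.cuspFunction 1 F', ?_, ?_⟩
  · intro w hw
    rw [mem_sphere_zero_iff_norm] at hw
    have hw0 : w ≠ 0 := by
      rintro rfl
      simp at hw
    rw [Complex.analyticAt_iff_eventually_differentiableAt]
    have hcont : ContinuousAt (fun v : ℂ => |(-1 / (2 * Real.pi)) * Real.log ‖v‖|) w := by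
      have : ‖w‖ ≠ 0 := norm_ne_zero_iff.mpr hw0
      fun_prop (disch := assumption)
    have hlt := hcont.eventually_lt (g := fun _ => ε) continuousAt_const (by simpa [hw] using hε)
    filter_upwards [hlt, isOpen_ne.mem_nhds hw0] with v hv hv0
    rw [← Function.Periodic.im_invQParam] at hv
    have := Function.Periodic.differentiableAt_cuspFunction one_ne_zero hper' (hdiff _ hv)
    rwa [Function.Periodic.qParam_right_inv one_ne_zero hv0] at this
  · intro t
    rw [hunit, Function.Periodic.eq_cuspFunction one_ne_zero hper', hfF]
    simp [F', hε]

lemma integral_unitAddCircle_eq_circleAverage {f : UnitAddCircle → ℂ} {φ : ℂ → ℂ}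
    (hfφ : ∀ t : ℝ, f (t : UnitAddCircle) = φ (unitExp t)) :
    ∫ y : UnitAddCircle, Real.log ‖f y‖ = Real.circleAverage (fun z => Real.log ‖φ z‖) 0 1 := by
  rw [← UnitAddCircle.intervalIntegral_preimage 0, ← integral_comp_unitExp]
  simp only [hfφ, zero_add]

/-- Zeros give only logarithmic singularities; the rest is transport of measure. With `Real.log 0 =
0` the case `φ = 0` is harmless. -/
lemma integrable_log_norm_unitAddCircle {f : UnitAddCircle → ℂ} {φ : ℂ → ℂ}
    (hφ : AnalyticOnNhd ℂ φ (Metric.sphere 0 1))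
    (hfφ : ∀ t : ℝ, f (t : UnitAddCircle) = φ (unitExp t)) :
    MeasureTheory.Integrable (fun y : UnitAddCircle => Real.log ‖f y‖) := by
  have hcirc : CircleIntegrable (fun z => Real.log ‖φ z‖) 0 1 :=
    MeromorphicOn.circleIntegrable_log_norm (by simpa using hφ.meromorphicOn)
  have hint : IntervalIntegrable (fun t => Real.log ‖f (t : UnitAddCircle)‖)
      MeasureTheory.volume 0 1 := by
    have h := ((circleIntegrable_def _ _ _).mp hcirc).comp_mul_left (c := 2 * Real.pi)
    rw [zero_div, div_self (by positivity)] at h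
    simpa only [hfφ, unitExp] using h
  have hioc : MeasureTheory.IntegrableOn (fun t : ℝ => Real.log ‖f (t : UnitAddCircle)‖)
      (Set.Ioc (0 : ℝ) (0 + 1)) := by
    rw [zero_add]
    exact (intervalIntegrable_iff_integrableOn_Ioc_of_le zero_le_one).mp hint
  have hmap : MeasureTheory.volume.map (AddCircle.measurableEquivIoc 1 0) =
      MeasureTheory.Measure.comap Subtype.val MeasureTheory.volume :=
    (AddCircle.measurePreserving_equivIoc 1 (a := 0)).map_eq
  have hsub := (MeasureTheory.integrableOn_iff_comap_subtypeVal measurableSet_Ioc).mp hioc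
  rw [← hmap, MeasureTheory.integrable_map_equiv] at hsub
  refine hsub.congr (MeasureTheory.ae_of_all _ fun y => ?_)
  simp only [Function.comp_apply]
  congr 3
  exact (AddCircle.equivIoc 1 0).symm_apply_apply y

lemma norm_unitExp_sub_unitExp (a b : ℝ) :
    ‖unitExp a - unitExp b‖ = ‖1 - unitExp (a - b)‖ := by
  have h : unitExp a - unitExp b = -(unitExp b * (1 - unitExp (a - b))) := by
    rw [mul_sub, ← unitExp_add, add_sub_cancel]
    ring
  rw [h, norm_neg, norm_mul, norm_unitExp, one_mul]

/-! ### Assembly at the good times -/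

/-- This value of `R` is what cancels the factor `q n / q (n + 1)` in the comparison with the
rational rotation. -/
lemma exists_convergentData {α : ℝ} (hα : Irrational α) :
    ∃ K : ℝ, 1 ≤ K ∧ ∃ (p : ℕ → ℤ) (n : ℕ → ℕ), StrictMono n ∧ ∀ l,
      ConvergentData α p (cfDen α) (n l)
        (K * ((cfDen α (n l + 1) : ℝ) / cfDen α (n l))) := by
  obtain ⟨p, hp⟩ := exists_convergent_numerators hα
  have hpos : ∀ k, (0 : ℝ) < cfDen α k := fun k => by exact_mod_cast (hp k).1
  have hmono : ∀ k, (cfDen α k : ℝ) ≤ cfDen α (k + 1) := fun k => by exact_mod_cast (hp k).2.1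
  obtain ⟨K, hK, n, hn, hKn⟩ := exists_strictMono_forall_lt_le_mul
    (r := fun k => (cfDen α (k + 1) : ℝ) / cfDen α k)
    (fun k => (one_le_div (hpos k)).mpr (hmono k))
  refine ⟨K, hK, p, n, hn, fun l => ?_⟩
  refine ⟨cfDen_zero α, fun k => (hp k).1, fun k => (hp k).2.1, fun k => (hp k).2.2.1,
    fun k => (hp k).2.2.2.trans ?_, (hp _).2.2.2, ?_, fun i hi => ?_⟩
  · rw [sq]
    exact one_div_le_one_div_of_le (mul_pos (hpos k) (hpos k))
      (mul_le_mul_of_nonneg_left (hmono k) (hpos k).le)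
  · have := hpos (n l)
    have := hpos (n l + 1)
    positivity
  · exact (div_le_iff₀ (hpos i)).mp (hKn l i hi)

/-- The Birkhoff sums of `log ‖φ‖` at good times are bounded above by their mean up to a constant,
at every point whose orbit segment avoids the zeros of `φ`. -/
lemma exists_sum_log_norm_le {φ : ℂ → ℂ} (hφ : AnalyticOnNhd ℂ φ (Metric.sphere 0 1))
    (hne : ∃ z ∈ Metric.sphere (0 : ℂ) 1, φ z ≠ 0) {K : ℝ} (hK : 1 ≤ K) :
    ∃ C : ℝ, 0 < C ∧ ∀ {α : ℝ} {p : ℕ → ℤ} {q : ℕ → ℕ} {n : ℕ},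
      ConvergentData α p q n (K * ((q (n + 1) : ℝ) / q n)) → ∀ x : ℝ,
      (∀ j ∈ Finset.range (q n), φ (unitExp (x + j * α)) ≠ 0) →
      ∑ j ∈ Finset.range (q n), Real.log ‖φ (unitExp (x + j * α))‖ ≤
        q n * Real.circleAverage (fun z => Real.log ‖φ z‖) 0 1 + C := by
  obtain ⟨s, m, g, hs, hm, hg, hg0, heq⟩ := exists_eq_prod_sub_pow_mul hφ hne
  obtain ⟨L, hL⟩ := exists_lipschitzWith_log_norm hg hg0
  -- Once `R = K * q (n + 1) / q n` is inserted, this bounds each singular sum independently of `α`,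
  -- `n` and `x`.
  set C₀ : ℝ := 2 * Real.log 2 + 3600 * (K + 7) with hC₀
  have hlog2 : 0 ≤ Real.log 2 := Real.log_nonneg (by norm_num)
  have hC₀pos : 0 ≤ C₀ := by positivity
  refine ⟨∑ u ∈ s, (m u : ℝ) * C₀ + 2 * L + 1, by positivity, ?_⟩
  intro α p q n h x hx
  have hQ : (0 : ℝ) < q n := by exact_mod_cast h.den_pos n
  have hQ' : (0 : ℝ) < q (n + 1) := by exact_mod_cast h.den_pos (n + 1)
  have hmono : (q n : ℝ) ≤ q (n + 1) := by exact_mod_cast h.den_mono n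
  have hsing : ∀ u ∈ s,
      ∑ j ∈ Finset.range (q n), Real.log ‖unitExp (x + j * α) - u‖ ≤ C₀ := by
    intro u hu
    obtain ⟨a, rfl⟩ := exists_unitExp_eq (hs u hu)
    have hterm : ∀ j : ℕ, ‖unitExp (x + j * α) - unitExp a‖ =
        ‖1 - unitExp ((x - a) + j * α)‖ := by
      intro j
      rw [norm_unitExp_sub_unitExp]
      congr 3
      ring
    simp only [hterm]
    refine (h.sum_log_norm_one_sub_unitExp_le fun j hj h1 => ?_).trans ?_
    · apply hx j hj
      have h2 : unitExp (x + j * α) - unitExp a = 0 := by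
        rw [← norm_eq_zero, hterm, h1, sub_self, norm_zero]
      rw [heq _ (unitExp_mem_sphere _), Finset.prod_eq_zero hu, zero_mul]
      rw [h2, zero_pow (hm _ hu)]
    · have h3 : 3600 * (K * ((q (n + 1) : ℝ) / q n) + 7) * q n / q (n + 1) =
          3600 * (K + 7 * (q n / q (n + 1))) := by
        field_simp
      have h4 : (q n : ℝ) / q (n + 1) ≤ 1 := (div_le_one hQ').mpr hmono
      rw [h3, hC₀]
      linarith
  have hreg := sum_lipschitz_le_mul_integral_add (φ := fun z => Real.log ‖g z‖) hL
    (h.den_pos n) (h.coprime n) (h.abs_sub_le_sq n) x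
  rw [integral_comp_unitExp (fun z => Real.log ‖g z‖), ← circleAverage_log_norm_eq hs hg hg0 heq] at hreg
  have hsplit : ∀ j ∈ Finset.range (q n), Real.log ‖φ (unitExp (x + j * α))‖ =
      ∑ u ∈ s, (m u : ℝ) * Real.log ‖unitExp (x + j * α) - u‖ +
        Real.log ‖g (unitExp (x + j * α))‖ := by
    intro j hj
    have h0 := hx j hj
    rw [heq _ (unitExp_mem_sphere _)] at h0 ⊢
    have h1 := left_ne_zero_of_mul h0
    rw [norm_mul, Real.log_mul (norm_ne_zero_iff.mpr h1)
      (norm_ne_zero_iff.mpr (right_ne_zero_of_mul h0)), norm_prod, Real.log_prod]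
    · simp [Real.log_pow]
    · intro u hu
      exact norm_ne_zero_iff.mpr (Finset.prod_ne_zero_iff.mp h1 u hu)
  rw [Finset.sum_congr rfl hsplit, Finset.sum_add_distrib, Finset.sum_comm]
  have hsum : ∑ u ∈ s, ∑ j ∈ Finset.range (q n),
      (m u : ℝ) * Real.log ‖unitExp (x + j * α) - u‖ ≤ ∑ u ∈ s, (m u : ℝ) * C₀ := by
    refine Finset.sum_le_sum fun u hu => ?_
    rw [← Finset.mul_sum]
    exact mul_le_mul_of_nonneg_left (hsing u hu) (Nat.cast_nonneg _)
  linarith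

lemma sum_logAbs_eq_bot {ι : Type*} {s : Finset ι} {w : ι → ℂ} {i : ι} (hi : i ∈ s)
    (hw : w i = 0) : ∑ j ∈ s, logAbs (w j) = ⊥ := by
  classical
  rw [← Finset.add_sum_erase s _ hi, hw, logAbs_zero, EReal.bot_add]

lemma sum_logAbs_eq_coe {ι : Type*} {s : Finset ι} {w : ι → ℂ} (hw : ∀ i ∈ s, w i ≠ 0) :
    ∑ j ∈ s, logAbs (w j) = ((∑ j ∈ s, Real.log ‖w j‖ : ℝ) : EReal) := by
  classical
  induction s using Finset.induction_on with
  | empty => simp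
  | insert a t ha ih =>
    rw [Finset.sum_insert ha, Finset.sum_insert ha, EReal.coe_add,
      ih fun i hi => hw i (Finset.mem_insert_of_mem hi),
      logAbs_of_ne_zero (hw a (Finset.mem_insert_self a t))]

theorem theorem2p3 (f : UnitAddCircle → ℂ) (hf : AnalyticNearCircle f) (hf0 : ∃ x, f x ≠ 0)
    (α : ℝ) (hα : Irrational α) :
    MeasureTheory.Integrable (fun y : UnitAddCircle => Real.log ‖f y‖) MeasureTheory.volume ∧
    ∃ C : ℝ, 0 < C ∧ ∃ n : ℕ → ℕ, StrictMono n ∧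
      ∀ (l : ℕ) (x : UnitAddCircle),
        ((1 / (cfDen α (n l) : ℝ) : ℝ) : EReal) *
            (∑ j ∈ Finset.range (cfDen α (n l)), logAbs (f (x + ((j * α : ℝ) : UnitAddCircle))))
          - ((∫ y : UnitAddCircle, Real.log ‖f y‖ : ℝ) : EReal)
        ≤ ((C / (cfDen α (n l) : ℝ) : ℝ) : EReal) := by
  obtain ⟨φ, hφ, hfφ⟩ := hf.exists_analyticOnNhd
  refine ⟨integrable_log_norm_unitAddCircle hφ hfφ, ?_⟩
  have hne : ∃ z ∈ Metric.sphere (0 : ℂ) 1, φ z ≠ 0 := by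
    obtain ⟨x, hx⟩ := hf0
    obtain ⟨t, rfl⟩ := QuotientAddGroup.mk_surjective x
    exact ⟨unitExp t, unitExp_mem_sphere t, hfφ t ▸ hx⟩
  obtain ⟨K, hK, p, n, hn, hdata⟩ := exists_convergentData hα
  obtain ⟨C, hC, hbound⟩ := exists_sum_log_norm_le hφ hne hK
  refine ⟨C, hC, n, hn, fun l x => ?_⟩
  have hQ : (0 : ℝ) < cfDen α (n l) := by exact_mod_cast (hdata l).den_pos (n l)
  obtain ⟨t, rfl⟩ := QuotientAddGroup.mk_surjective x
  have hpt : ∀ j : ℕ, f ((t : UnitAddCircle) + ((j * α : ℝ) : UnitAddCircle)) =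
      φ (unitExp (t + j * α)) := fun j => by
    rw [← hfφ]
    rfl
  -- If the orbit meets a zero, the left-hand side is `⊥`; otherwise every term is real.
  by_cases hz : ∃ j ∈ Finset.range (cfDen α (n l)), φ (unitExp (t + j * α)) = 0
  · obtain ⟨j, hj, hj0⟩ := hz
    rw [sum_logAbs_eq_bot hj ((hpt j).trans hj0),
      EReal.coe_mul_bot_of_pos (one_div_pos.mpr hQ), EReal.bot_sub]
    exact bot_le
  · push Not at hz
    rw [sum_logAbs_eq_coe fun j hj => (hpt j).symm ▸ hz j hj, ← EReal.coe_mul, ← EReal.coe_sub,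
      EReal.coe_le_coe_iff, integral_unitAddCircle_eq_circleAverage hfφ]
    have h := hbound (hdata l) t hz
    simp only [hpt]
    rw [sub_le_iff_le_add, one_div_mul_eq_div, div_le_iff₀ hQ, add_mul, div_mul_cancel₀ _ hQ.ne']
    linarith
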